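/- **Conventions.** A measurable space $(S,\mathfrak S)$ is a set $S$ with a $\sigma$-ring $\mathfrak S$ of subsets of $S$ (closed under countable unions and differences, $\emptyset\in\mathfrak S$); a measure is a $\sigma$-additive $\mu:\mathfrak S\to[0,\infty]$ with $\mu(\emptyset)=0$; $(S,\mathfrak S,\mu)$ is then a measure space. Put $\mathfrak S^{f}_\mu=\{A\in\mathfrak S:\mu(A)<\infty\}$, and let $\mathfrak S_\mu^\sigma$ be the $\sigma$-ring of $\sigma$-finite sets, i.e. of countable unions of members of $\mathfrak S^f_\mu$. A function $f$ (with values in $\mathbb R$, $[0,\infty]$ or $[-\infty,\infty]$) is $\mathfrak S$-measurable if it is measurable with respect to the $\sigma$-algebra on $S$ generated by $\mathfrak S$ and $\{f\ne0\}\in\mathfrak S$. It is $\mu$-integrable if it is $\mathfrak S$-measurable and $\int|f|\,d\mu<\infty$; then $\int f\,d\mu=\int f^+d\mu-\int f^-d\mu$. A property holds $\mu$-almost everywhere if it holds outside some $N\in\mathfrak S$ with $\mu(N)=0$. For measure spaces $(S,\mathfrak S,\mu)$ and $(T,\mathfrak T,\nu)$, $\mathfrak S\otimes\mathfrak T$ is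 the $\sigma$-ring generated by the rectangles $A\times B$, $A\in\mathfrak S$, $B\in\mathfrak T$. The product $\mu\otimes\nu$ is the measure on $\mathfrak S\otimes\mathfrak T$ given by $$(\mu\otimes\nu)(C)=\inf\Big\{\sum_n\mu(A_n)\nu(B_n):\ C\subset\bigcup_n A_n\times B_n,\ A_n\in\mathfrak S^f_\mu,\ B_n\in\mathfrak T^f_\nu\Big\},\qquad \inf\emptyset=\infty.$$ Let $\mathcal P_\mu$ be the real linear span of the indicators $1_A$, $A\in\mathfrak S_\mu^f$, and $\tilde\mu:\mathcal P_\mu\to\mathbb R$ the linear functional with $\tilde\mu(1_A)=\mu(A)$. Let $\mathcal P_\mu\otimes\mathcal P_\nu$ be the span of the functions $(s,t)\mapsto u(s)v(t)$, $u\in\mathcal P_\mu$, $v\in\mathcal P_\nu$, and $(\tilde\mu\otimes\tilde\nu)(f)=\tilde\mu\big(s\mapsto\tilde\nu(f(s,\cdot))\big)$ on it. For a linear functional $I$ on a space $L$ of real functions and $f$ with values in $[-\infty,\infty]$, let $\overline I(f)$ be the infimum of $\lim_n I(\varphi_n)$ over all non-decreasing sequences $(\varphi_n)$ in $L$ with $f\le\lim_n\varphi_n$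 pointwise, and $\underline I(f)=-\overline I(-f)$. The function $f$ is Daniell–Stone integrable if $\overline I(f)=\underline I(f)\in\mathbb R$, and this number is its Daniell–Stone integral $\int f\,dI$. **Theorem.** Let $(S,\mathfrak S,\mu)$ and $(T,\mathfrak T,\nu)$ be arbitrary (not necessarily $\sigma$-finite) measure spaces. (0) $\mu\otimes\nu$ is the unique measure on $\mathfrak S\otimes\mathfrak T$ such that $(\mu\otimes\nu)(A\times B)=\mu(A)\nu(B)$ for all $A\in\mathfrak S^f_\mu$, $B\in\mathfrak T^f_\nu$, and such that its $\sigma$-ring of $\sigma$-finite sets is the $\sigma$-ring generated by the sets $A\times B$ with $A\in\mathfrak S^f_\mu$, $B\in\mathfrak T^f_\nu$. (i) An $\mathfrak S\otimes\mathfrak T$-measurable function $f:S\times T\to[-\infty,\infty]$ is $\mu\otimes\nu$-integrable if and only if it is Daniell–Stone integrable with respect to $\tilde\mu\otimes\tilde\nu$, and then $\int f\,d(\mu\otimes\nu)=\int f\,d(\tilde\mu\otimes\tilde\nu)$. (ii) (Fubini) Let $f:S\times T\to[-\infty,\infty]$ be $\mu\otimes\nu$-integrable. Then $f(s,\cdot)$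 is $\nu$-integrable for $\mu$-almost every $s$, and $f(\cdot,t)$ is $\mu$-integrable for $\nu$-almost every $t$. The functions $s\mapsto\int f(s,\cdot)\,d\nu$ and $t\mapsto\int f(\cdot,t)\,d\mu$ (set to be $0$ where the section is not integrable) are $\mu$-integrable and $\nu$-integrable respectively, and $$\int f\,d(\mu\otimes\nu)=\int\Big(\int f(s,\cdot)\,d\nu\Big)d\mu(s)=\int\Big(\int f(\cdot,t)\,d\mu\Big)d\nu(t).\tag{1}$$ (iii) (Tonelli) Let $f:S\times T\to[0,\infty]$ be $\mathfrak S\otimes\mathfrak T$-measurable. Then $f$ is $\mathfrak S_\mu^\sigma\otimes\mathfrak T_\nu^\sigma$-measurable if and only if $\{f\neq0\}$ is $\sigma$-finite for $\mu\otimes\nu$. In that case all sections $f(s,\cdot)$ and $f(\cdot,t)$ are $\mathfrak T$- and $\mathfrak S$-measurable, the functions $s\mapsto\int f(s,\cdot)\,d\nu$ and $t\mapsto\int f(\cdot,t)\,d\mu$ are $\mathfrak S$- and $\mathfrak T$-measurable, the equalities (1) hold in $[0,\infty]$, and if any one of the three sides of (1) is finite, then $f$ is $\mu\otimes\nu$-integrable.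 -/

import Mathlib

open MeasureTheory Set
open scoped ENNReal

noncomputable section

/-- A `σ`-ring of subsets of `α`: a nonempty family of sets that is closed under differences and
countable unions. -/
structure SigmaRing (α : Type*) where
  carrier : Set (Set α)
  empty_mem : ∅ ∈ carrier
  diff_mem : ∀ A ∈ carrier, ∀ B ∈ carrier, A \ B ∈ carrier
  iUnion_mem : ∀ A : ℕ → Set α, (∀ n, A n ∈ carrier) → (⋃ n, A n) ∈ carrier

namespace SigmaRing

variable {α β : Type*}

instance : Membership (Set α) (SigmaRing α) := ⟨fun R A => A ∈ R.carrier⟩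

/-- The smallest `σ`-ring that contains the family `C`. -/
def generate (C : Set (Set α)) : SigmaRing α where
  carrier := {A | ∀ R : SigmaRing α, C ⊆ R.carrier → A ∈ R}
  empty_mem := fun R _ => R.empty_mem
  diff_mem := fun A hA B hB R hR => R.diff_mem A (hA R hR) B (hB R hR)
  iUnion_mem := fun A hA R hR => R.iUnion_mem A fun n => hA n R hR

/-- A `σ`-algebra, regarded as a `σ`-ring. -/
def ofMeasurableSpace (m : MeasurableSpace α) : SigmaRing α where
  carrier := {A | MeasurableSet[m] A}
  empty_mem := @MeasurableSet.empty α m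
  diff_mem := fun _ hA _ hB => @MeasurableSet.diff α m _ _ hA hB
  iUnion_mem := fun _ hA => @MeasurableSet.iUnion α ℕ m _ _ hA

/-- The product `σ`-ring, generated by the rectangles `A × B` with `A ∈ R` and `B ∈ Q`. -/
def prod (R : SigmaRing α) (Q : SigmaRing β) : SigmaRing (α × β) :=
  generate {C | ∃ A ∈ R, ∃ B ∈ Q, C = A ×ˢ B}

/-- The `σ`-algebra on the whole space `α` generated by the `σ`-ring. -/
@[reducible]
def toMeasurableSpace (R : SigmaRing α) : MeasurableSpace α :=
  MeasurableSpace.generateFrom R.carrier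

/-- Measurability with respect to a `σ`-ring: `f` is measurable with respect to the generated
`σ`-algebra, and the set where `f` does not vanish belongs to the `σ`-ring. -/
def MeasurableFun {γ : Type*} [Zero γ] [MeasurableSpace γ] (R : SigmaRing α) (f : α → γ) : Prop :=
  Measurable[R.toMeasurableSpace] f ∧ {x | f x ≠ 0} ∈ R

theorem union_mem (R : SigmaRing α) {A B : Set α} (hA : A ∈ R) (hB : B ∈ R) : A ∪ B ∈ R := by
  have h : A ∪ B = ⋃ n : ℕ, (if n = 0 then A else B) := by
    ext x
    simp only [mem_union, mem_iUnion]
    constructor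
    · rintro (h | h)
      · exact ⟨0, by simpa using h⟩
      · exact ⟨1, by simpa using h⟩
    · rintro ⟨n, hn⟩
      split_ifs at hn
      · exact Or.inl hn
      · exact Or.inr hn
  rw [h]
  refine R.iUnion_mem _ fun n => ?_
  split_ifs
  · exact hA
  · exact hB

theorem inter_mem (R : SigmaRing α) {A B : Set α} (hA : A ∈ R) (hB : B ∈ R) : A ∩ B ∈ R := by
  rw [← sdiff_sdiff_right_self]
  exact R.diff_mem A hA _ (R.diff_mem A hA B hB)

theorem measurableSet_of_mem (R : SigmaRing α) {A : Set α} (hA : A ∈ R) :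
    MeasurableSet[R.toMeasurableSpace] A :=
  MeasurableSpace.measurableSet_generateFrom hA

theorem mem_or_compl_mem (R : SigmaRing α) {A : Set α}
    (hA : MeasurableSet[R.toMeasurableSpace] A) : A ∈ R ∨ Aᶜ ∈ R := by
  induction A, hA using MeasurableSpace.generateFrom_induction with
  | hC A hA _ => exact Or.inl hA
  | empty => exact Or.inl R.empty_mem
  | compl A _ h => rw [compl_compl]; exact h.symm
  | iUnion A _ h =>
    by_cases hn : ∀ n, A n ∈ R
    · exact Or.inl (R.iUnion_mem A hn)
    · obtain ⟨n, hn⟩ := not_forall.1 hn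
      have hc : (A n)ᶜ ∈ R := (h n).resolve_left hn
      right
      have e : (⋃ m, A m)ᶜ = (A n)ᶜ \ ⋃ m, ((A n)ᶜ ∩ A m) := by
        ext x
        simp only [mem_compl_iff, mem_iUnion, mem_sdiff, mem_inter_iff]
        grind
      rw [e]
      refine R.diff_mem _ hc _ (R.iUnion_mem _ fun m => ?_)
      rcases h m with h | h
      · exact R.inter_mem hc h
      · rw [← sdiff_compl]
        exact R.diff_mem _ hc _ h

end SigmaRing

/-- A measure on a `σ`-ring `R`: a `σ`-additive function `R → [0, ∞]` that is `0` at `∅`. Only the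
values at members of `R` are relevant. -/
structure RingMeasure {α : Type*} (R : SigmaRing α) where
  toFun : Set α → ℝ≥0∞
  empty' : toFun ∅ = 0
  iUnion' : ∀ A : ℕ → Set α, (∀ n, A n ∈ R) → Pairwise (Function.onFun Disjoint A) →
    toFun (⋃ n, A n) = ∑' n, toFun (A n)

namespace RingMeasure

variable {α β : Type*} {R : SigmaRing α} {Q : SigmaRing β}

instance : CoeFun (RingMeasure R) (fun _ => Set α → ℝ≥0∞) := ⟨RingMeasure.toFun⟩

/-- The sets of finite measure. -/
def finiteSets (μ : RingMeasure R) : Set (Set α) := {A | A ∈ R ∧ μ A < ∞}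

/-- The `σ`-finite sets: unions of sequences of sets of finite measure. -/
def SigmaFiniteSet (μ : RingMeasure R) (A : Set α) : Prop :=
  ∃ B : ℕ → Set α, (∀ n, B n ∈ μ.finiteSets) ∧ A = ⋃ n, B n

theorem union_disjoint (μ : RingMeasure R) {A B : Set α} (hA : A ∈ R) (hB : B ∈ R)
    (h : Disjoint A B) : μ (A ∪ B) = μ A + μ B := by
  have hu : (⋃ n : ℕ, (if n = 0 then A else if n = 1 then B else ∅)) = A ∪ B := by
    ext x
    simp only [mem_union, mem_iUnion]
    constructor
    · rintro ⟨n, hn⟩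
      split_ifs at hn
      · exact Or.inl hn
      · exact Or.inr hn
      · exact hn.elim
    · rintro (h | h)
      · exact ⟨0, by simpa using h⟩
      · exact ⟨1, by simpa using h⟩
  rw [← hu, μ.iUnion']
  · rw [tsum_eq_sum (s := Finset.range 2)]
    · simp [Finset.sum_range_succ]
    · intro n hn
      have h0 : n ≠ 0 := by rintro rfl; simp at hn
      have h1 : n ≠ 1 := by rintro rfl; simp at hn
      simp [h0, h1, μ.empty']
  · intro n
    split_ifs
    exacts [hA, hB, R.empty_mem]
  · intro i j hij
    simp only [Function.onFun]
    split_ifs <;> first | omega | exact h | exact h.symm | simp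

theorem mono (μ : RingMeasure R) {A B : Set α} (hA : A ∈ R) (hB : B ∈ R) (h : A ⊆ B) :
    μ A ≤ μ B := by
  have := μ.union_disjoint hA (R.diff_mem B hB A hA) disjoint_sdiff_right
  rw [union_sdiff_cancel h] at this
  rw [this]
  exact le_self_add

theorem finiteSets_diff (μ : RingMeasure R) {A B : Set α} (hA : A ∈ μ.finiteSets) (hB : B ∈ R) :
    A \ B ∈ μ.finiteSets :=
  ⟨R.diff_mem A hA.1 B hB, (μ.mono (R.diff_mem A hA.1 B hB) hA.1 sdiff_subset).trans_lt hA.2⟩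

theorem finiteSets_inter (μ : RingMeasure R) {A B : Set α} (hA : A ∈ μ.finiteSets) (hB : B ∈ R) :
    A ∩ B ∈ μ.finiteSets :=
  ⟨R.inter_mem hA.1 hB, (μ.mono (R.inter_mem hA.1 hB) hA.1 inter_subset_left).trans_lt hA.2⟩

theorem iUnion_le (μ : RingMeasure R) (A : ℕ → Set α) (hA : ∀ n, A n ∈ R) :
    μ (⋃ n, A n) ≤ ∑' n, μ (A n) := by
  have hB : ∀ n, disjointed A n ∈ R := fun n =>
    disjointedRec (p := fun C => C ∈ R) (fun _ i ht => R.diff_mem _ ht _ (hA i)) (hA n)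
  rw [← iUnion_disjointed, μ.iUnion' _ hB (disjoint_disjointed A)]
  exact ENNReal.tsum_le_tsum fun n => μ.mono (hB n) (hA n) (disjointed_subset A n)

/-- The `σ`-ring of the `σ`-finite sets. -/
def sigmaFiniteRing (μ : RingMeasure R) : SigmaRing α where
  carrier := {A | μ.SigmaFiniteSet A}
  empty_mem := ⟨fun _ => ∅, fun _ => ⟨R.empty_mem, by simp [μ.empty']⟩, by simp⟩
  diff_mem := by
    rintro _ ⟨A, hA, rfl⟩ _ ⟨B, hB, rfl⟩
    exact ⟨fun n => A n \ ⋃ m, B m,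
      fun n => μ.finiteSets_diff (hA n) (R.iUnion_mem _ fun m => (hB m).1), iUnion_sdiff _ _⟩
  iUnion_mem := by
    intro A hA
    choose B hB hAB using hA
    refine ⟨fun k => B k.unpair.1 k.unpair.2, fun k => hB _ _, ?_⟩
    rw [iUnion_unpair (fun i j => B i j)]
    exact iUnion_congr hAB

/-- A property holds almost everywhere if it holds outside a set of measure zero. -/
def AE (μ : RingMeasure R) (p : α → Prop) : Prop :=
  ∃ N ∈ R, μ N = 0 ∧ ∀ x ∉ N, p x

/-! ### The Lebesgue integral -/

/-- The outer measure induced by `μ`. -/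
def outer (μ : RingMeasure R) : OuterMeasure α :=
  inducedOuterMeasure (P := fun A => A ∈ R) (fun A _ => μ A) R.empty_mem μ.empty'

theorem outer_of_mem (μ : RingMeasure R) {A : Set α} (hA : A ∈ R) : μ.outer A = μ A :=
  inducedOuterMeasure_eq' (P := fun A => A ∈ R) (m := fun A _ => μ A)
    (fun f hf => R.iUnion_mem f hf) (fun f hf => μ.iUnion_le f hf)
    (fun _ _ h₁ h₂ h => μ.mono h₁ h₂ h) hA

theorem toMeasurableSpace_le (μ : RingMeasure R) :
    R.toMeasurableSpace ≤ μ.outer.caratheodory := by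
  refine MeasurableSpace.generateFrom_le fun A hA => ?_
  refine (inducedOuterMeasure_caratheodory (P := fun A => A ∈ R) (m := fun A _ => μ A)
    (fun f hf => R.iUnion_mem f hf) (fun f hf => μ.iUnion_le f hf)
    (fun _ _ h₁ h₂ h => μ.mono h₁ h₂ h) A).2 fun B hB => ?_
  change μ.outer (B ∩ A) + μ.outer (B \ A) ≤ μ.outer B
  rw [μ.outer_of_mem hB, μ.outer_of_mem (R.inter_mem hB hA), μ.outer_of_mem (R.diff_mem B hB A hA),
    ← μ.union_disjoint (R.inter_mem hB hA) (R.diff_mem B hB A hA) disjoint_sdiff_inter.symm,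
    inter_union_sdiff]

/-- The extension of `μ` to the `σ`-algebra generated by `R`, with the value `∞` at measurable sets
that are not in `R`. -/
def toMeasure (μ : RingMeasure R) : @Measure α R.toMeasurableSpace :=
  @OuterMeasure.toMeasure α R.toMeasurableSpace μ.outer μ.toMeasurableSpace_le

theorem toMeasure_apply (μ : RingMeasure R) {A : Set α} (hA : A ∈ R) : μ.toMeasure A = μ A := by
  let _ := R.toMeasurableSpace
  exact (MeasureTheory.toMeasure_apply μ.outer μ.toMeasurableSpace_le
    (R.measurableSet_of_mem hA)).trans (μ.outer_of_mem hA)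

theorem toMeasure_apply_of_notMem (μ : RingMeasure R) {A : Set α}
    (hA : MeasurableSet[R.toMeasurableSpace] A) (hA' : A ∉ R) : μ.toMeasure A = ∞ := by
  let _ := R.toMeasurableSpace
  refine (MeasureTheory.toMeasure_apply μ.outer μ.toMeasurableSpace_le hA).trans ?_
  by_contra h
  obtain ⟨B, hB, hAB, -⟩ := inducedOuterMeasure_exists_set (P := fun A => A ∈ R)
    (m := fun A _ => μ A) (fun f hf => R.iUnion_mem f hf) (fun f hf => μ.iUnion_le f hf)
    (fun _ _ h₁ h₂ h => μ.mono h₁ h₂ h) h one_ne_zero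
  have hc : Aᶜ ∈ R := (R.mem_or_compl_mem hA).resolve_left hA'
  have e : A = B \ Aᶜ := by rw [sdiff_compl, inter_eq_right.2 hAB]
  exact hA' (e ▸ R.diff_mem B hB _ hc)

/-- The extended Lebesgue integral of a nonnegative function, meant for functions that are
measurable with respect to the `σ`-ring `R`. Simple functions below such a function vanish outside
a member of `R`, so that only the values of `μ` at members of `R` matter. -/
def lintegral (μ : RingMeasure R) (f : α → ℝ≥0∞) : ℝ≥0∞ := ∫⁻ x, f x ∂μ.toMeasure

/-- `μ`-integrability of an extended real function: it is measurable with respect to the `σ`-ring,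
and its absolute value has a finite integral. -/
def Integrable (μ : RingMeasure R) (f : α → EReal) : Prop :=
  R.MeasurableFun f ∧ μ.lintegral (fun x => (f x).abs) < ∞

open Classical in
/-- The Lebesgue integral of a `μ`-integrable function, `∫ f⁺ dμ - ∫ f⁻ dμ` (by convention `0` for
functions that are not integrable). -/
def integral (μ : RingMeasure R) (f : α → EReal) : ℝ :=
  if μ.Integrable f then
    (μ.lintegral fun x => (f x).toENNReal).toReal - (μ.lintegral fun x => (-f x).toENNReal).toReal
  else 0

/-! ### The product of arbitrary measures -/

/-- The outer measure `C ↦ inf ∑ μ(Aₙ) ν(Bₙ)`, over all countable covers of `C` by rectangles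
`Aₙ × Bₙ` whose sides have finite measure; it is `∞` if there is no such cover. -/
def prodOuter (μ : RingMeasure R) (ν : RingMeasure Q) : OuterMeasure (α × β) :=
  OuterMeasure.ofFunction
    (fun C => ⨅ (A : Set α) (B : Set β) (_ : A ∈ μ.finiteSets) (_ : B ∈ ν.finiteSets)
      (_ : C = A ×ˢ B), μ A * ν B)
    (by
      refine le_antisymm ?_ zero_le
      refine (iInf_le_of_le ∅ <| iInf_le_of_le ∅ <|
        iInf_le_of_le ⟨R.empty_mem, by simp [μ.empty']⟩ <|
        iInf_le_of_le ⟨Q.empty_mem, by simp [ν.empty']⟩ <|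
        iInf_le_of_le (by simp) ?_)
      simp [μ.empty'])

theorem prodOuter_le (μ : RingMeasure R) (ν : RingMeasure Q) {A : Set α} {B : Set β}
    (hA : A ∈ μ.finiteSets) (hB : B ∈ ν.finiteSets) :
    μ.prodOuter ν (A ×ˢ B) ≤ μ A * ν B :=
  (OuterMeasure.ofFunction_le _).trans <|
    iInf_le_of_le A <| iInf_le_of_le B <| iInf_le_of_le hA <| iInf_le_of_le hB <| iInf_le _ rfl

theorem prodOuter_inter_add_diff_le (μ : RingMeasure R) (ν : RingMeasure Q) {A A' : Set α}
    {B B' : Set β} (hA : A ∈ R) (hB : B ∈ Q) (hA' : A' ∈ μ.finiteSets) (hB' : B' ∈ ν.finiteSets) :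
    μ.prodOuter ν (A' ×ˢ B' ∩ A ×ˢ B) + μ.prodOuter ν (A' ×ˢ B' \ A ×ˢ B) ≤ μ A' * ν B' := by
  have h₁ : A' ×ˢ B' ∩ A ×ˢ B = (A' ∩ A) ×ˢ (B' ∩ B) := prod_inter_prod
  have h₂ : A' ×ˢ B' \ A ×ˢ B ⊆ (A' \ A) ×ˢ B' ∪ (A' ∩ A) ×ˢ (B' \ B) := by
    rintro ⟨x, y⟩
    simp only [mem_sdiff, mem_prod, mem_union, mem_inter_iff]
    tauto
  have e₁ : μ A' = μ (A' ∩ A) + μ (A' \ A) := by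
    rw [← μ.union_disjoint (R.inter_mem hA'.1 hA) (R.diff_mem _ hA'.1 _ hA)
      disjoint_sdiff_inter.symm, inter_union_sdiff]
  have e₂ : ν B' = ν (B' ∩ B) + ν (B' \ B) := by
    rw [← ν.union_disjoint (Q.inter_mem hB'.1 hB) (Q.diff_mem _ hB'.1 _ hB)
      disjoint_sdiff_inter.symm, inter_union_sdiff]
  calc μ.prodOuter ν (A' ×ˢ B' ∩ A ×ˢ B) + μ.prodOuter ν (A' ×ˢ B' \ A ×ˢ B)
      ≤ μ (A' ∩ A) * ν (B' ∩ B) + (μ (A' \ A) * ν B' + μ (A' ∩ A) * ν (B' \ B)) := by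
        refine add_le_add ?_ ?_
        · rw [h₁]
          exact μ.prodOuter_le ν (μ.finiteSets_inter hA' hA) (ν.finiteSets_inter hB' hB)
        · exact (measure_mono h₂).trans <| (measure_union_le _ _).trans <| add_le_add
            (μ.prodOuter_le ν (μ.finiteSets_diff hA' hA) hB')
            (μ.prodOuter_le ν (μ.finiteSets_inter hA' hA) (ν.finiteSets_diff hB' hB))
    _ = μ A' * ν B' := by rw [e₁, e₂]; ring

theorem prod_le_caratheodory (μ : RingMeasure R) (ν : RingMeasure Q) {C : Set (α × β)}
    (hC : C ∈ R.prod Q) : (μ.prodOuter ν).IsCaratheodory C := by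
  refine hC (SigmaRing.ofMeasurableSpace (μ.prodOuter ν).caratheodory) ?_
  rintro _ ⟨A, hA, B, hB, rfl⟩
  refine (OuterMeasure.isCaratheodory_iff_le _).2 fun D => le_iInf₂ fun F hF => ?_
  have key : ∀ n, μ.prodOuter ν (F n ∩ A ×ˢ B) + μ.prodOuter ν (F n \ A ×ˢ B) ≤
      ⨅ (A' : Set α) (B' : Set β) (_ : A' ∈ μ.finiteSets) (_ : B' ∈ ν.finiteSets)
        (_ : F n = A' ×ˢ B'), μ A' * ν B' := by
    intro n
    simp only [le_iInf_iff]
    rintro A' B' hA' hB' hn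
    rw [hn]
    exact μ.prodOuter_inter_add_diff_le ν hA hB hA' hB'
  calc μ.prodOuter ν (D ∩ A ×ˢ B) + μ.prodOuter ν (D \ A ×ˢ B)
      ≤ (∑' n, μ.prodOuter ν (F n ∩ A ×ˢ B)) + ∑' n, μ.prodOuter ν (F n \ A ×ˢ B) := by
        refine add_le_add ?_ ?_
        · refine (measure_mono ?_).trans (measure_iUnion_le _)
          rw [← iUnion_inter]
          exact inter_subset_inter_left _ hF
        · refine (measure_mono ?_).trans (measure_iUnion_le _)
          rw [← iUnion_sdiff]
          exact sdiff_subset_sdiff_left hF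
    _ = ∑' n, (μ.prodOuter ν (F n ∩ A ×ˢ B) + μ.prodOuter ν (F n \ A ×ˢ B)) :=
        ENNReal.tsum_add.symm
    _ ≤ _ := ENNReal.tsum_le_tsum key

/-- The product measure `μ ⊗ ν` on the product `σ`-ring, for arbitrary `μ` and `ν`: the
Carathéodory measure that is obtained from the rectangles with sides of finite measure. -/
def prod (μ : RingMeasure R) (ν : RingMeasure Q) : RingMeasure (R.prod Q) where
  toFun := μ.prodOuter ν
  empty' := measure_empty
  iUnion' := fun _ hA hd =>
    OuterMeasure.f_iUnion _ (fun n => μ.prod_le_caratheodory ν (hA n)) hd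

/-- The two properties that characterize the product measure: it has the expected values at
rectangles with sides of finite measure, and its `σ`-ring of `σ`-finite sets is generated by these
rectangles. -/
structure IsProduct (μ : RingMeasure R) (ν : RingMeasure Q) (ρ : RingMeasure (R.prod Q)) :
    Prop where
  rect : ∀ A ∈ μ.finiteSets, ∀ B ∈ ν.finiteSets, ρ (A ×ˢ B) = μ A * ν B
  sigmaFinite : ρ.sigmaFiniteRing =
    SigmaRing.generate {C | ∃ A ∈ μ.finiteSets, ∃ B ∈ ν.finiteSets, C = A ×ˢ B}

/-! ### The elementary functionals -/

/-- The space of simple functions: the linear span of the indicators of the sets of finite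
measure. -/
def simpleSpace (μ : RingMeasure R) : Submodule ℝ (α → ℝ) :=
  Submodule.span ℝ {f | ∃ A ∈ μ.finiteSets, f = A.indicator 1}

theorem integrable_of_mem (μ : RingMeasure R) {f : α → ℝ} (hf : f ∈ μ.simpleSpace) :
    MeasureTheory.Integrable f μ.toMeasure := by
  induction hf using Submodule.span_induction with
  | mem f hf =>
    obtain ⟨A, hA, rfl⟩ := hf
    rw [integrable_indicator_iff (R.measurableSet_of_mem hA.1)]
    exact integrableOn_const (by rw [μ.toMeasure_apply hA.1]; exact hA.2.ne)
  | zero => exact integrable_zero _ _ _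
  | add f g _ _ hf hg => exact hf.add hg
  | smul c f _ hf => exact hf.smul c

/-- The linear functional on simple functions associated with the measure; it is determined by
`1_A ↦ μ(A)`, see `simpleFunctional_indicator`. -/
def simpleFunctional (μ : RingMeasure R) : μ.simpleSpace →ₗ[ℝ] ℝ where
  toFun f := ∫ x, (f : α → ℝ) x ∂μ.toMeasure
  map_add' f g := integral_add (μ.integrable_of_mem f.2) (μ.integrable_of_mem g.2)
  map_smul' c _ := integral_const_mul c _

theorem simpleFunctional_indicator (μ : RingMeasure R) {A : Set α} (hA : A ∈ μ.finiteSets) :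
    μ.simpleFunctional ⟨A.indicator 1, Submodule.subset_span ⟨A, hA, rfl⟩⟩ = (μ A).toReal := by
  change ∫ x, A.indicator 1 x ∂μ.toMeasure = _
  rw [integral_indicator_one (R.measurableSet_of_mem hA.1), measureReal_def,
    μ.toMeasure_apply hA.1]

/-- The tensor product of the two spaces of simple functions, as a space of functions on `α × β`:
the linear span of the products `(x, y) ↦ u(x) v(y)`. -/
def tensorSpace (μ : RingMeasure R) (ν : RingMeasure Q) : Submodule ℝ (α × β → ℝ) :=
  Submodule.span ℝ {f | ∃ u ∈ μ.simpleSpace, ∃ v ∈ ν.simpleSpace, f = fun z => u z.1 * v z.2}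

theorem section_mem (μ : RingMeasure R) (ν : RingMeasure Q) {f : α × β → ℝ}
    (hf : f ∈ μ.tensorSpace ν) (x : α) : (fun y => f (x, y)) ∈ ν.simpleSpace := by
  induction hf using Submodule.span_induction with
  | mem f hf =>
    obtain ⟨u, _, v, hv, rfl⟩ := hf
    exact ν.simpleSpace.smul_mem (u x) hv
  | zero => exact ν.simpleSpace.zero_mem
  | add f g _ _ hf hg => exact ν.simpleSpace.add_mem hf hg
  | smul c f _ hf => exact ν.simpleSpace.smul_mem c hf

theorem partial_mem (μ : RingMeasure R) (ν : RingMeasure Q) {f : α × β → ℝ}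
    (hf : f ∈ μ.tensorSpace ν) :
    (fun x => ν.simpleFunctional ⟨fun y => f (x, y), section_mem μ ν hf x⟩) ∈ μ.simpleSpace := by
  induction hf using Submodule.span_induction with
  | mem f hf =>
    obtain ⟨u, hu, v, hv, rfl⟩ := hf
    convert μ.simpleSpace.smul_mem (ν.simpleFunctional ⟨v, hv⟩) hu using 1
    funext x
    have := ν.simpleFunctional.map_smul (u x) ⟨v, hv⟩
    simp only [smul_eq_mul] at this
    simp only [Pi.smul_apply, smul_eq_mul]
    rw [mul_comm, ← this]
    rfl
  | zero =>
    convert μ.simpleSpace.zero_mem using 1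
    funext x
    exact ν.simpleFunctional.map_zero
  | add f g hf' hg' hf hg =>
    convert μ.simpleSpace.add_mem hf hg using 1
    funext x
    exact ν.simpleFunctional.map_add ⟨_, section_mem μ ν hf' x⟩ ⟨_, section_mem μ ν hg' x⟩
  | smul c f hf' hf =>
    convert μ.simpleSpace.smul_mem c hf using 1
    funext x
    exact ν.simpleFunctional.map_smul c ⟨_, section_mem μ ν hf' x⟩

/-- The tensor product of the two functionals, `f ↦ μ̃(x ↦ ν̃(f(x, ·)))`. -/
def tensorFunctional (μ : RingMeasure R) (ν : RingMeasure Q) : μ.tensorSpace ν →ₗ[ℝ] ℝ where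
  toFun f := μ.simpleFunctional
    ⟨fun x => ν.simpleFunctional ⟨fun y => (f : α × β → ℝ) (x, y), section_mem μ ν f.2 x⟩,
      partial_mem μ ν f.2⟩
  map_add' f g := by
    rw [← map_add]
    congr 1
    ext x
    exact ν.simpleFunctional.map_add ⟨_, section_mem μ ν f.2 x⟩ ⟨_, section_mem μ ν g.2 x⟩
  map_smul' c f := by
    rw [RingHom.id_apply, ← map_smul]
    congr 1
    ext x
    exact ν.simpleFunctional.map_smul c ⟨_, section_mem μ ν f.2 x⟩

end RingMeasure

/-! ### The Daniell–Stone integral -/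

namespace Daniell

variable {α : Type*}

/-- The upper integral of `f`: the infimum of `lim I(φₙ)` over all non-decreasing sequences `φₙ` of
elementary functions whose pointwise limit (in `(-∞, ∞]`) is at least `f`. -/
def upperIntegral {L : Submodule ℝ (α → ℝ)} (I : L →ₗ[ℝ] ℝ) (f : α → EReal) : EReal :=
  ⨅ (φ : ℕ → L) (_ : ∀ x, Monotone fun n => (φ n : α → ℝ) x)
    (_ : ∀ x, f x ≤ ⨆ n, (((φ n : α → ℝ) x : ℝ) : EReal)), ⨆ n, ((I (φ n) : ℝ) : EReal)

/-- The lower integral of `f`. -/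
def lowerIntegral {L : Submodule ℝ (α → ℝ)} (I : L →ₗ[ℝ] ℝ) (f : α → EReal) : EReal :=
  -upperIntegral I (fun x => -f x)

/-- The domain of the Daniell–Stone extension: the upper and the lower integral are equal and
finite. -/
def Integrable {L : Submodule ℝ (α → ℝ)} (I : L →ₗ[ℝ] ℝ) (f : α → EReal) : Prop :=
  ∃ a : ℝ, upperIntegral I f = a ∧ lowerIntegral I f = a

/-- The Daniell–Stone integral: the common value of the upper and the lower integral. -/
def integral {L : Submodule ℝ (α → ℝ)} (I : L →ₗ[ℝ] ℝ) (f : α → EReal) : ℝ :=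
  (upperIntegral I f).toReal

end Daniell

end

/-!
The proof replaces the measures on `σ`-rings by ordinary measures. A `σ`-ring `R` is an ideal in the
`σ`-algebra that it generates, and a measure on `R` extends to this `σ`-algebra with the value `∞`
outside `R`.

A set of finite product measure is covered by countably many rectangles with sides of finite
measure, so that the `σ`-finite sets of `μ ⊗ ν` are generated by these rectangles
(`RingMeasure.sigmaFiniteRing_prod`). Within such a cover `E × F`, a measure is determined by its
values at rectangles (`RingMeasure.eq_prod_of_cover`), which yields the uniqueness. It also shows
that `μ ⊗ ν` is there the usual product of the `s`-finite measures `μ|E` and `ν|F`, on a smaller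
`σ`-algebra (`RingMeasure.restrict_toMeasure_prod`), and Tonelli's theorem for functions with
`σ`-finite support reduces to the theorem for `s`-finite measures. Fubini's theorem
follows by splitting into positive and negative parts, all identities being established between
finite integrals of nonnegative functions (`RingMeasure.integrable_partial_integral`).

For the Daniell–Stone integral, `μ̃ ⊗ ν̃` is integration against `μ ⊗ ν`. Monotone convergence shows
that the upper integral is at least the integral, and that a finite upper integral forces the
positive part to have a finite integral. Conversely, the definition of `μ ⊗ ν` by covers says that
an indicator is dominated by a series of nonnegative elementary functions with almost the same
integral; by countable subadditivity this extends to all nonnegative measurable functions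
(`Daniell.SeriesBound.lintegral`), and the upper integral of an integrable function is at most its
integral (`Daniell.IsIntegration.upperIntegral_le_integral`).
-/

/-! ### `σ`-rings -/

namespace SigmaRing

variable {α β : Type*}

theorem ext_mem {R Q : SigmaRing α} (h : ∀ A, A ∈ R ↔ A ∈ Q) : R = Q := by
  obtain ⟨r, _, _, _⟩ := R
  obtain ⟨q, _, _, _⟩ := Q
  obtain rfl : r = q := Set.ext h
  rfl

theorem mem_generate {C : Set (Set α)} {A : Set α} (hA : A ∈ C) : A ∈ generate C :=
  fun _ hR => hR hA

theorem prod_mem (R : SigmaRing α) (Q : SigmaRing β) {A : Set α} {B : Set β} (hA : A ∈ R)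
    (hB : B ∈ Q) : A ×ˢ B ∈ R.prod Q :=
  mem_generate ⟨A, hA, B, hB, rfl⟩

theorem toMeasurableSpace_generate (C : Set (Set α)) :
    (generate C).toMeasurableSpace = MeasurableSpace.generateFrom C := by
  refine le_antisymm (MeasurableSpace.generateFrom_le fun A hA => ?_)
    (MeasurableSpace.generateFrom_mono fun A hA => mem_generate hA)
  exact hA (ofMeasurableSpace (MeasurableSpace.generateFrom C))
    fun B hB => MeasurableSpace.measurableSet_generateFrom hB

/-- The members of a `σ`-ring form an ideal in the generated `σ`-algebra. -/
theorem inter_measurableSet_mem (R : SigmaRing α) {E M : Set α} (hE : E ∈ R)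
    (hM : MeasurableSet[R.toMeasurableSpace] M) : E ∩ M ∈ R := by
  rcases R.mem_or_compl_mem hM with h | h
  · exact R.inter_mem hE h
  · rw [← sdiff_compl]
    exact R.diff_mem E hE _ h

theorem mem_of_subset (R : SigmaRing α) {E M : Set α} (hE : E ∈ R)
    (hM : MeasurableSet[R.toMeasurableSpace] M) (h : M ⊆ E) : M ∈ R := by
  rw [← inter_eq_right.2 h]
  exact R.inter_measurableSet_mem hE hM

theorem measurableFun_of_support_subset {γ : Type*} [Zero γ] [MeasurableSpace γ]
    [MeasurableSingletonClass γ] (R : SigmaRing α) {f : α → γ} {E : Set α} (hE : E ∈ R)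
    (hf : Measurable[R.toMeasurableSpace] f) (h : ∀ x ∉ E, f x = 0) : R.MeasurableFun f := by
  refine ⟨hf, R.mem_of_subset hE ?_ fun x hx => by_contra fun hxE => hx (h x hxE)⟩
  let _ := R.toMeasurableSpace
  exact (hf (measurableSet_singleton 0)).compl

theorem toMeasurableSpace_prod_le (R : SigmaRing α) (Q : SigmaRing β) :
    (R.prod Q).toMeasurableSpace ≤ R.toMeasurableSpace.prod Q.toMeasurableSpace := by
  let _ := R.toMeasurableSpace
  let _ := Q.toMeasurableSpace
  rw [prod, toMeasurableSpace_generate]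
  refine MeasurableSpace.generateFrom_le ?_
  rintro _ ⟨A, hA, B, hB, rfl⟩
  exact (R.measurableSet_of_mem hA).prod (Q.measurableSet_of_mem hB)

/-- Sections of members of the product `σ`-ring belong to the second factor. -/
theorem preimage_mk_left_mem (R : SigmaRing α) (Q : SigmaRing β) {C : Set (α × β)}
    (hC : C ∈ R.prod Q) (x : α) : Prod.mk x ⁻¹' C ∈ Q := by
  refine hC ⟨{D | Prod.mk x ⁻¹' D ∈ Q}, Q.empty_mem,
    fun A hA B hB => Q.diff_mem _ hA _ hB, fun A hA => ?_⟩ ?_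
  · change Prod.mk x ⁻¹' (⋃ n, A n) ∈ Q
    rw [preimage_iUnion]
    exact Q.iUnion_mem _ hA
  · rintro _ ⟨A, hA, B, hB, rfl⟩
    change Prod.mk x ⁻¹' (A ×ˢ B) ∈ Q
    by_cases hx : x ∈ A
    · rwa [mk_preimage_prod_right hx]
    · rw [mk_preimage_prod_right_eq_empty hx]
      exact Q.empty_mem

theorem preimage_mk_right_mem (R : SigmaRing α) (Q : SigmaRing β) {C : Set (α × β)}
    (hC : C ∈ R.prod Q) (y : β) : (fun x => (x, y)) ⁻¹' C ∈ R := by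
  refine hC ⟨{D | (fun x => (x, y)) ⁻¹' D ∈ R}, R.empty_mem,
    fun A hA B hB => R.diff_mem _ hA _ hB, fun A hA => ?_⟩ ?_
  · change (fun x => (x, y)) ⁻¹' (⋃ n, A n) ∈ R
    rw [preimage_iUnion]
    exact R.iUnion_mem _ hA
  · rintro _ ⟨A, hA, B, hB, rfl⟩
    change (fun x => (x, y)) ⁻¹' (A ×ˢ B) ∈ R
    by_cases hy : y ∈ B
    · rwa [mk_preimage_prod_left hy]
    · rw [mk_preimage_prod_left_eq_empty hy]
      exact R.empty_mem

theorem MeasurableFun.section_left {γ : Type*} [Zero γ] [MeasurableSpace γ] {R : SigmaRing α}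
    {Q : SigmaRing β} {f : α × β → γ} (hf : (R.prod Q).MeasurableFun f) (x : α) :
    Q.MeasurableFun fun y => f (x, y) := by
  refine ⟨?_, R.preimage_mk_left_mem Q hf.2 x⟩
  let _ := R.toMeasurableSpace
  let _ := Q.toMeasurableSpace
  exact (hf.1.mono (R.toMeasurableSpace_prod_le Q) le_rfl).comp measurable_prodMk_left

theorem MeasurableFun.section_right {γ : Type*} [Zero γ] [MeasurableSpace γ] {R : SigmaRing α}
    {Q : SigmaRing β} {f : α × β → γ} (hf : (R.prod Q).MeasurableFun f) (y : β) :
    R.MeasurableFun fun x => f (x, y) := by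
  refine ⟨?_, R.preimage_mk_right_mem Q hf.2 y⟩
  let _ := R.toMeasurableSpace
  let _ := Q.toMeasurableSpace
  exact (hf.1.mono (R.toMeasurableSpace_prod_le Q) le_rfl).comp measurable_prodMk_right

/-- Two `σ`-rings `R ⊆ Q` such that `R` is an ideal in `Q` have the same measurable functions with
support in `R`. -/
theorem MeasurableFun.of_ideal {γ : Type*} [Zero γ] [MeasurableSpace γ] {R Q : SigmaRing α}
    (hRQ : ∀ E ∈ R, ∀ M ∈ Q, M ⊆ E → M ∈ R) (hle : ∀ E ∈ R, E ∈ Q) {f : α → γ}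
    (hf : Measurable[Q.toMeasurableSpace] f) (h0 : {x | f x ≠ 0} ∈ R) : R.MeasurableFun f := by
  refine ⟨fun U hU => ?_, h0⟩
  have key : ∀ V : Set γ, MeasurableSet[Q.toMeasurableSpace] (f ⁻¹' V) → (0 : γ) ∉ V →
      MeasurableSet[R.toMeasurableSpace] (f ⁻¹' V) := by
    intro V hV hV0
    have hsub : f ⁻¹' V ⊆ {x | f x ≠ 0} := fun x hx hx0 => hV0 (hx0 ▸ hx)
    exact R.measurableSet_of_mem (hRQ _ h0 _ (Q.mem_of_subset (hle _ h0) hV hsub) hsub)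
  by_cases hU0 : (0 : γ) ∈ U
  · refine MeasurableSet.of_compl ?_
    rw [← preimage_compl]
    refine key Uᶜ (hf hU.compl) (by simpa using hU0)
  · exact key U (hf hU) hU0

end SigmaRing

/-! ### The product measure -/

namespace RingMeasure

variable {α β : Type*} {R : SigmaRing α} {Q : SigmaRing β}

theorem restrict_toMeasure_le (μ : RingMeasure R) {A : Set α} {B : Set α} (hA : A ∈ R) :
    @Measure.restrict α R.toMeasurableSpace μ.toMeasure B A ≤ μ A := by
  let _ := R.toMeasurableSpace
  rw [← μ.toMeasure_apply hA]
  exact Measure.restrict_apply_le _ _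

theorem prod_apply (μ : RingMeasure R) (ν : RingMeasure Q) (C : Set (α × β)) :
    μ.prod ν C = μ.prodOuter ν C := rfl

theorem prodOuter_rect (μ : RingMeasure R) (ν : RingMeasure Q) {A : Set α} {B : Set β}
    (hA : A ∈ μ.finiteSets) (hB : B ∈ ν.finiteSets) :
    μ.prodOuter ν (A ×ˢ B) = μ A * ν B := by
  refine le_antisymm (μ.prodOuter_le ν hA hB) ?_
  let _ := R.toMeasurableSpace
  let _ := Q.toMeasurableSpace
  have hA' := μ.toMeasure_apply hA.1
  have hB' := ν.toMeasure_apply hB.1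
  have : IsFiniteMeasure (μ.toMeasure.restrict A) := ⟨by simpa [hA'] using hA.2⟩
  have : IsFiniteMeasure (ν.toMeasure.restrict B) := ⟨by simpa [hB'] using hB.2⟩
  -- The product of the restrictions to the finite sets `A` and `B` is a lower bound for each cover.
  set P := (μ.toMeasure.restrict A).prod (ν.toMeasure.restrict B) with hP
  have h : P.toOuterMeasure ≤ μ.prodOuter ν := by
    refine OuterMeasure.le_ofFunction.2 fun C => ?_
    simp only [le_iInf_iff]
    rintro A' B' hA' hB' rfl
    change P (A' ×ˢ B') ≤ _
    rw [hP, Measure.prod_prod]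
    exact mul_le_mul' (μ.restrict_toMeasure_le hA'.1) (ν.restrict_toMeasure_le hB'.1)
  refine le_trans (le_of_eq ?_) (h (A ×ˢ B))
  change _ = P (A ×ˢ B)
  rw [hP, Measure.prod_prod, Measure.restrict_apply_self, Measure.restrict_apply_self, hA', hB']

/-- A set of finite outer measure has almost optimal covers by rectangles. -/
theorem exists_cover_of_prodOuter_lt_top (μ : RingMeasure R) (ν : RingMeasure Q) {C : Set (α × β)}
    (hC : μ.prodOuter ν C ≠ ∞) {ε : ℝ≥0∞} (hε : ε ≠ 0) :
    ∃ (A : ℕ → Set α) (B : ℕ → Set β), (∀ n, A n ∈ μ.finiteSets) ∧ (∀ n, B n ∈ ν.finiteSets) ∧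
      C ⊆ ⋃ n, A n ×ˢ B n ∧ ∑' n, μ (A n) * ν (B n) ≤ μ.prodOuter ν C + ε := by
  have hε2 : ε / 2 ≠ 0 := by simpa using hε
  have hlt := ENNReal.lt_add_right hC hε2
  conv_lhs at hlt => rw [prodOuter, OuterMeasure.ofFunction_apply]
  simp only [iInf_lt_iff] at hlt
  obtain ⟨F, hF, hlt⟩ := hlt
  obtain ⟨δ, hδ, hδε⟩ := ENNReal.exists_pos_sum_of_countable' hε2 ℕ
  have hfin := ENNReal.ne_top_of_tsum_ne_top hlt.ne_top
  have key := fun n => ENNReal.lt_add_right (hfin n) (hδ n).ne'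
  simp only [iInf_lt_iff] at key
  choose A B hA hB hFAB hle using key
  refine ⟨A, B, hA, hB, hF.trans (iUnion_mono fun n => (hFAB n).subset), ?_⟩
  calc ∑' n, μ (A n) * ν (B n) ≤ _ := ENNReal.tsum_le_tsum fun n => (hle n).le
    _ = _ := ENNReal.tsum_add
    _ ≤ (μ.prodOuter ν C + ε / 2) + ε / 2 := add_le_add hlt.le hδε.le
    _ = _ := by rw [add_assoc, ENNReal.add_halves]

theorem mem_finiteSets_prod (μ : RingMeasure R) (ν : RingMeasure Q) {A : Set α} {B : Set β}
    (hA : A ∈ μ.finiteSets) (hB : B ∈ ν.finiteSets) : A ×ˢ B ∈ (μ.prod ν).finiteSets := by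
  refine ⟨R.prod_mem Q hA.1 hB.1, ?_⟩
  rw [prod_apply, μ.prodOuter_rect ν hA hB]
  exact ENNReal.mul_lt_top hA.2 hB.2

/-- The `σ`-ring generated by the rectangles with sides of finite measure. -/
abbrev finiteRectRing (μ : RingMeasure R) (ν : RingMeasure Q) : SigmaRing (α × β) :=
  SigmaRing.generate {C | ∃ A ∈ μ.finiteSets, ∃ B ∈ ν.finiteSets, C = A ×ˢ B}

theorem inter_rect_mem_finiteRectRing (μ : RingMeasure R) (ν : RingMeasure Q) {A : Set α}
    {B : Set β} (hA : A ∈ μ.finiteSets) (hB : B ∈ ν.finiteSets) {C : Set (α × β)}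
    (hC : C ∈ R.prod Q) : C ∩ A ×ˢ B ∈ μ.finiteRectRing ν := by
  set G := μ.finiteRectRing ν with hG
  refine hC ⟨{D | D ∩ A ×ˢ B ∈ G}, ?_, fun D hD E hE => ?_, fun D hD => ?_⟩ ?_
  · change ∅ ∩ _ ∈ G
    rw [empty_inter]
    exact G.empty_mem
  · change (D \ E) ∩ _ ∈ G
    rw [inter_sdiff_distrib_right]
    exact G.diff_mem _ hD _ hE
  · change (⋃ n, D n) ∩ _ ∈ G
    rw [iUnion_inter]
    exact G.iUnion_mem _ hD
  · rintro _ ⟨A', hA', B', hB', rfl⟩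
    change A' ×ˢ B' ∩ A ×ˢ B ∈ G
    rw [prod_inter_prod, inter_comm A', inter_comm B']
    exact SigmaRing.mem_generate
      ⟨_, μ.finiteSets_inter hA hA', _, ν.finiteSets_inter hB hB', rfl⟩

/-- A set of finite product measure has a countable cover by rectangles of finite measure, and it
meets each of them in a member of the `σ`-ring that they generate. -/
theorem sigmaFiniteRing_prod (μ : RingMeasure R) (ν : RingMeasure Q) :
    (μ.prod ν).sigmaFiniteRing = μ.finiteRectRing ν := by
  refine SigmaRing.ext_mem fun C => ⟨?_, fun hC => hC _ ?_⟩
  · rintro ⟨D, hD, rfl⟩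
    refine SigmaRing.iUnion_mem _ _ fun n => ?_
    obtain ⟨A, B, hA, hB, hsub, -⟩ :=
      μ.exists_cover_of_prodOuter_lt_top ν (hD n).2.ne one_ne_zero
    rw [← inter_eq_left.2 hsub, inter_iUnion]
    exact SigmaRing.iUnion_mem _ _ fun k =>
      μ.inter_rect_mem_finiteRectRing ν (hA k) (hB k) (hD n).1
  · rintro _ ⟨A, hA, B, hB, rfl⟩
    exact ⟨fun _ => A ×ˢ B, fun _ => μ.mem_finiteSets_prod ν hA hB, (iUnion_const _).symm⟩

theorem isProduct_prod (μ : RingMeasure R) (ν : RingMeasure Q) : IsProduct μ ν (μ.prod ν) :=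
  ⟨fun _ hA _ hB => μ.prodOuter_rect ν hA hB, μ.sigmaFiniteRing_prod ν⟩

theorem exists_cover_of_mem_finiteRectRing (μ : RingMeasure R) (ν : RingMeasure Q)
    {C : Set (α × β)} (hC : C ∈ μ.finiteRectRing ν) :
    ∃ (A : ℕ → Set α) (B : ℕ → Set β), (∀ n, A n ∈ μ.finiteSets) ∧ (∀ n, B n ∈ ν.finiteSets) ∧
      C ⊆ ⋃ n, A n ×ˢ B n := by
  rw [← sigmaFiniteRing_prod] at hC
  obtain ⟨D, hD, rfl⟩ := hC
  choose A B hA hB hsub _ using fun n =>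
    μ.exists_cover_of_prodOuter_lt_top ν (hD n).2.ne one_ne_zero
  refine ⟨fun k => A k.unpair.1 k.unpair.2, fun k => B k.unpair.1 k.unpair.2, fun k => hA _ _,
    fun k => hB _ _, ?_⟩
  rw [iUnion_unpair (fun i j => A i j ×ˢ B i j)]
  exact iUnion_mono hsub

/-- Two measures on the product `σ`-ring agree at the subsets of a rectangle of finite measure if
they agree at its subrectangles, which form a `π`-system. -/
theorem eq_of_subset_rect (μ : RingMeasure R) (ν : RingMeasure Q)
    {ρ₁ ρ₂ : RingMeasure (R.prod Q)}
    {A : Set α} {B : Set β} (hA : A ∈ μ.finiteSets) (hB : B ∈ ν.finiteSets)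
    (h : ∀ A' ∈ μ.finiteSets, A' ⊆ A → ∀ B' ∈ ν.finiteSets, B' ⊆ B →
      ρ₁ (A' ×ˢ B') = ρ₂ (A' ×ˢ B'))
    (hfin : ρ₁ (A ×ˢ B) ≠ ∞) {C : Set (α × β)} (hC : C ∈ R.prod Q) (hsub : C ⊆ A ×ˢ B) :
    ρ₁ C = ρ₂ C := by
  let _ := (R.prod Q).toMeasurableSpace
  have hAB := R.prod_mem Q hA.1 hB.1
  have hmAB := (R.prod Q).measurableSet_of_mem hAB
  have : IsFiniteMeasure (ρ₁.toMeasure.restrict (A ×ˢ B)) :=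
    ⟨by simpa [ρ₁.toMeasure_apply hAB] using hfin.lt_top⟩
  have key : ρ₁.toMeasure.restrict (A ×ˢ B) = ρ₂.toMeasure.restrict (A ×ˢ B) := by
    refine ext_of_generate_finite {C | ∃ A ∈ R, ∃ B ∈ Q, C = A ×ˢ B}
      (SigmaRing.toMeasurableSpace_generate _) ?_ ?_ ?_
    · rintro _ ⟨A₁, h₁, B₁, h₁', rfl⟩ _ ⟨A₂, h₂, B₂, h₂', rfl⟩ -
      exact ⟨_, R.inter_mem h₁ h₂, _, Q.inter_mem h₁' h₂', prod_inter_prod⟩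
    · rintro _ ⟨A', hA', B', hB', rfl⟩
      rw [Measure.restrict_apply' hmAB, Measure.restrict_apply' hmAB, prod_inter_prod,
        inter_comm A', inter_comm B']
      have h₁ := μ.finiteSets_inter hA hA'
      have h₂ := ν.finiteSets_inter hB hB'
      have h₃ := R.prod_mem Q h₁.1 h₂.1
      rw [ρ₁.toMeasure_apply h₃, ρ₂.toMeasure_apply h₃,
        h _ h₁ inter_subset_left _ h₂ inter_subset_left]
    · rw [Measure.restrict_apply_univ, Measure.restrict_apply_univ, ρ₁.toMeasure_apply hAB,
        ρ₂.toMeasure_apply hAB, h _ hA Subset.rfl _ hB Subset.rfl]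
  have := congrArg (fun m : Measure (α × β) => m C) key
  simp only [Measure.restrict_apply' hmAB, inter_eq_left.2 hsub] at this
  rwa [ρ₁.toMeasure_apply hC, ρ₂.toMeasure_apply hC] at this

/-- A measure on the product `σ`-ring that has the expected values at all subrectangles of a
sequence of rectangles with sides of finite measure agrees with the product measure at the sets
that are covered by this sequence. -/
theorem eq_prod_of_cover (μ : RingMeasure R) (ν : RingMeasure Q) {ρ : RingMeasure (R.prod Q)}
    {A : ℕ → Set α} {B : ℕ → Set β} (hA : ∀ n, A n ∈ μ.finiteSets) (hB : ∀ n, B n ∈ ν.finiteSets)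
    (h : ∀ n, ∀ A' ∈ μ.finiteSets, A' ⊆ A n → ∀ B' ∈ ν.finiteSets, B' ⊆ B n →
      ρ (A' ×ˢ B') = μ A' * ν B')
    {C : Set (α × β)} (hC : C ∈ R.prod Q) (hsub : C ⊆ ⋃ n, A n ×ˢ B n) :
    ρ C = μ.prod ν C := by
  have hmem : ∀ n, disjointed (fun n => A n ×ˢ B n) n ∈ R.prod Q := fun n =>
    disjointedRec (p := fun C => C ∈ R.prod Q)
      (fun _ i ht => (R.prod Q).diff_mem _ ht _ (R.prod_mem Q (hA i).1 (hB i).1))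
      (R.prod_mem Q (hA n).1 (hB n).1)
  have hCn := fun n => (R.prod Q).inter_mem hC (hmem n)
  have e : C = ⋃ n, C ∩ disjointed (fun n => A n ×ˢ B n) n := by
    rw [← inter_iUnion, iUnion_disjointed, inter_eq_left.2 hsub]
  have hd : Pairwise (Function.onFun Disjoint
      fun n => C ∩ disjointed (fun n => A n ×ˢ B n) n) := fun i j hij =>
    (disjoint_disjointed (fun n => A n ×ˢ B n) hij).mono inter_subset_right inter_subset_right
  rw [e, ρ.iUnion' _ hCn hd, (μ.prod ν).iUnion' _ hCn hd]
  refine tsum_congr fun n => ?_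
  refine μ.eq_of_subset_rect ν (hA n) (hB n) (fun A' hA' hsA B' hB' hsB => ?_) ?_ (hCn n)
    (inter_subset_right.trans (disjointed_subset _ n))
  · rw [h n A' hA' hsA B' hB' hsB]
    exact (μ.prodOuter_rect ν hA' hB').symm
  · rw [h n _ (hA n) Subset.rfl _ (hB n) Subset.rfl]
    exact (ENNReal.mul_lt_top (hA n).2 (hB n).2).ne

theorem IsProduct.eq_prod {μ : RingMeasure R} {ν : RingMeasure Q} {ρ : RingMeasure (R.prod Q)}
    (h : IsProduct μ ν ρ) {C : Set (α × β)} (hC : C ∈ R.prod Q) : ρ C = μ.prod ν C := by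
  by_cases hG : C ∈ μ.finiteRectRing ν
  · obtain ⟨A, B, hA, hB, hsub⟩ := μ.exists_cover_of_mem_finiteRectRing ν hG
    exact μ.eq_prod_of_cover ν hA hB (fun _ A' hA' _ B' hB' _ => h.rect A' hA' B' hB') hC hsub
  -- A set that is not `σ`-finite has infinite measure for both.
  · have key : ∀ ρ : RingMeasure (R.prod Q), IsProduct μ ν ρ → ρ C = ∞ := by
      intro ρ hρ
      by_contra hne
      refine hG ?_
      have : C ∈ ρ.sigmaFiniteRing :=
        ⟨fun _ => C, fun _ => ⟨hC, lt_top_iff_ne_top.2 hne⟩, (iUnion_const _).symm⟩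
      rwa [hρ.sigmaFinite] at this
    rw [key ρ h, key _ (μ.isProduct_prod ν)]

end RingMeasure

/-! ### Tonelli's theorem -/

namespace RingMeasure

variable {α β : Type*} {R : SigmaRing α} {Q : SigmaRing β}

theorem sFinite_restrict_iUnion (μ : RingMeasure R) {A : ℕ → Set α}
    (hA : ∀ n, A n ∈ μ.finiteSets) :
    @SFinite α R.toMeasurableSpace
      (@Measure.restrict α R.toMeasurableSpace μ.toMeasure (⋃ n, A n)) := by
  let _ := R.toMeasurableSpace
  have hm : ∀ n, MeasurableSet (A n) := fun n => R.measurableSet_of_mem (hA n).1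
  rw [← iUnion_disjointed, Measure.restrict_iUnion (disjoint_disjointed A) (.disjointed hm)]
  have : ∀ n, IsFiniteMeasure (μ.toMeasure.restrict (disjointed A n)) := fun n => by
    refine ⟨?_⟩
    rw [Measure.restrict_apply_univ]
    refine (measure_mono (disjointed_subset A n)).trans_lt ?_
    rw [μ.toMeasure_apply (hA n).1]
    exact (hA n).2
  infer_instance

/-- The restriction of the product measure to a product of `σ`-finite sets is the usual product of
`s`-finite measures, restricted to the smaller `σ`-algebra. -/
theorem restrict_toMeasure_prod (μ : RingMeasure R) (ν : RingMeasure Q) {A : ℕ → Set α}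
    {B : ℕ → Set β} (hA : ∀ n, A n ∈ μ.finiteSets) (hB : ∀ n, B n ∈ ν.finiteSets) :
    @Measure.restrict _ (R.prod Q).toMeasurableSpace (μ.prod ν).toMeasure
        ((⋃ n, A n) ×ˢ ⋃ n, B n) =
      (@Measure.prod α β R.toMeasurableSpace Q.toMeasurableSpace
        (@Measure.restrict α R.toMeasurableSpace μ.toMeasure (⋃ n, A n))
        (@Measure.restrict β Q.toMeasurableSpace ν.toMeasure (⋃ n, B n))).trim
        (R.toMeasurableSpace_prod_le Q) := by
  let _ := R.toMeasurableSpace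
  let _ := Q.toMeasurableSpace
  have hsA := μ.sFinite_restrict_iUnion hA
  have hsB := ν.sFinite_restrict_iUnion hB
  have hE := R.iUnion_mem A fun n => (hA n).1
  have hF := Q.iUnion_mem B fun n => (hB n).1
  set E := ⋃ n, A n
  set F := ⋃ n, B n
  set P := (μ.toMeasure.restrict E).prod (ν.toMeasure.restrict F) with hP
  -- `P` has the right values at the subrectangles of the rectangles `A i × B j`, which cover
  -- `E × F`.
  have hle := R.toMeasurableSpace_prod_le Q
  have hm : ∀ C ∈ R.prod Q, MeasurableSet C := fun C hC =>
    hle _ ((R.prod Q).measurableSet_of_mem hC)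
  let ρ : RingMeasure (R.prod Q) :=
    ⟨fun C => P C, measure_empty, fun C hC hd => measure_iUnion hd fun n => hm _ (hC n)⟩
  have key : ∀ C ∈ R.prod Q, C ⊆ E ×ˢ F → P C = μ.prod ν C := by
    intro C hC hsub
    refine μ.eq_prod_of_cover ν (ρ := ρ) (A := fun k => A k.unpair.1) (B := fun k => B k.unpair.2)
      (fun k => hA _) (fun k => hB _) (fun k A' hA' hsA B' hB' hsB => ?_) hC ?_
    · change P (A' ×ˢ B') = _
      rw [hP, Measure.prod_prod, Measure.restrict_eq_self _ (hsA.trans (subset_iUnion _ _)),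
        Measure.restrict_eq_self _ (hsB.trans (subset_iUnion _ _)), μ.toMeasure_apply hA'.1,
        ν.toMeasure_apply hB'.1]
    · rw [iUnion_unpair (fun i j => A i ×ˢ B j)]
      refine hsub.trans ?_
      rintro ⟨x, y⟩ ⟨hx, hy⟩
      obtain ⟨i, hi⟩ := mem_iUnion.1 hx
      obtain ⟨j, hj⟩ := mem_iUnion.1 hy
      exact mem_iUnion₂.2 ⟨i, j, hi, hj⟩
  have hEF := R.prod_mem Q hE hF
  refine @Measure.ext _ (R.prod Q).toMeasurableSpace _ _ fun M hM => ?_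
  have hM' := (R.prod Q).inter_measurableSet_mem hEF hM
  have hnull : P (E ×ˢ F)ᶜ = 0 := by
    rw [compl_prod_eq_union, hP]
    refine measure_union_null ?_ ?_ <;> rw [Measure.prod_prod]
    · rw [Measure.restrict_apply (R.measurableSet_of_mem hE).compl]
      simp
    · rw [Measure.restrict_apply (Q.measurableSet_of_mem hF).compl]
      simp
  rw [trim_measurableSet_eq _ hM, @Measure.restrict_apply _ (R.prod Q).toMeasurableSpace _ _ _ hM,
    inter_comm, toMeasure_apply _ hM', ← key _ hM' inter_subset_left, inter_comm,
    measure_inter_conull hnull]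

theorem lintegral_eq_setLIntegral (μ : RingMeasure R) {f : α → ℝ≥0∞} {E : Set α}
    (h0 : ∀ x ∉ E, f x = 0) :
    μ.lintegral f = ∫⁻ x, f x ∂@Measure.restrict α R.toMeasurableSpace μ.toMeasure E := by
  let _ := R.toMeasurableSpace
  exact (setLIntegral_eq_of_support_subset fun x hx => by_contra fun h => hx (h0 x h)).symm

/-- Tonelli's theorem for a function that vanishes outside a union of countably many rectangles
with sides of finite measure. -/
theorem tonelli_of_cover (μ : RingMeasure R) (ν : RingMeasure Q) {A : ℕ → Set α} {B : ℕ → Set β}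
    (hA : ∀ n, A n ∈ μ.finiteSets) (hB : ∀ n, B n ∈ ν.finiteSets) {f : α × β → ℝ≥0∞}
    (hf : Measurable[(R.prod Q).toMeasurableSpace] f)
    (hsub : {z | f z ≠ 0} ⊆ ⋃ n, A n ×ˢ B n) :
    R.MeasurableFun (fun x => ν.lintegral fun y => f (x, y)) ∧
    Q.MeasurableFun (fun y => μ.lintegral fun x => f (x, y)) ∧
    (μ.prod ν).lintegral f = μ.lintegral (fun x => ν.lintegral fun y => f (x, y)) ∧
    (μ.prod ν).lintegral f = ν.lintegral (fun y => μ.lintegral fun x => f (x, y)) := by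
  have hres := μ.restrict_toMeasure_prod ν hA hB
  have hsA := μ.sFinite_restrict_iUnion hA
  have hsB := ν.sFinite_restrict_iUnion hB
  have hE := R.iUnion_mem A fun n => (hA n).1
  have hF := Q.iUnion_mem B fun n => (hB n).1
  have h0 : ∀ z ∉ (⋃ n, A n) ×ˢ ⋃ n, B n, f z = 0 := by
    intro z hz
    by_contra hne
    obtain ⟨n, hn⟩ := mem_iUnion.1 (hsub hne)
    exact hz ⟨mem_iUnion.2 ⟨n, hn.1⟩, mem_iUnion.2 ⟨n, hn.2⟩⟩
  set E := ⋃ n, A n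
  set F := ⋃ n, B n
  have hν : ∀ x, ν.lintegral (fun y => f (x, y)) =
      ∫⁻ y, f (x, y) ∂@Measure.restrict β Q.toMeasurableSpace ν.toMeasure F :=
    fun x => ν.lintegral_eq_setLIntegral fun y hy => h0 _ fun h => hy h.2
  have hμ : ∀ y, μ.lintegral (fun x => f (x, y)) =
      ∫⁻ x, f (x, y) ∂@Measure.restrict α R.toMeasurableSpace μ.toMeasure E :=
    fun y => μ.lintegral_eq_setLIntegral fun x hx => h0 _ fun h => hx h.1
  have hν0 : ∀ x ∉ E, ν.lintegral (fun y => f (x, y)) = 0 := by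
    intro x hx
    have : (fun y => f (x, y)) = fun _ => 0 := funext fun y => h0 _ fun h => hx h.1
    rw [this, lintegral, lintegral_zero]
  have hμ0 : ∀ y ∉ F, μ.lintegral (fun x => f (x, y)) = 0 := by
    intro y hy
    have : (fun x => f (x, y)) = fun _ => 0 := funext fun x => h0 _ fun h => hy h.2
    rw [this, lintegral, lintegral_zero]
  rw [(μ.prod ν).lintegral_eq_setLIntegral h0, μ.lintegral_eq_setLIntegral hν0,
    ν.lintegral_eq_setLIntegral hμ0, hres, lintegral_trim _ hf]
  let _ := R.toMeasurableSpace
  let _ := Q.toMeasurableSpace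
  have hf' : Measurable f := hf.mono (R.toMeasurableSpace_prod_le Q) le_rfl
  refine ⟨R.measurableFun_of_support_subset hE ?_ hν0,
    Q.measurableFun_of_support_subset hF ?_ hμ0, ?_, ?_⟩
  · simp only [hν]
    exact hf'.lintegral_prod_right'
  · simp only [hμ]
    exact hf'.lintegral_prod_left'
  · simp only [hν]
    exact lintegral_prod _ hf'.aemeasurable
  · simp only [hμ]
    exact lintegral_prod_symm' _ hf'

theorem tonelli (μ : RingMeasure R) (ν : RingMeasure Q) {f : α × β → ℝ≥0∞}
    (hf : Measurable[(R.prod Q).toMeasurableSpace] f)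
    (hs : (μ.prod ν).SigmaFiniteSet {z | f z ≠ 0}) :
    R.MeasurableFun (fun x => ν.lintegral fun y => f (x, y)) ∧
    Q.MeasurableFun (fun y => μ.lintegral fun x => f (x, y)) ∧
    (μ.prod ν).lintegral f = μ.lintegral (fun x => ν.lintegral fun y => f (x, y)) ∧
    (μ.prod ν).lintegral f = ν.lintegral (fun y => μ.lintegral fun x => f (x, y)) := by
  have hs' : {z | f z ≠ 0} ∈ μ.finiteRectRing ν := by
    rw [← sigmaFiniteRing_prod]
    exact hs
  obtain ⟨A, B, hA, hB, hsub⟩ := μ.exists_cover_of_mem_finiteRectRing ν hs'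
  exact μ.tonelli_of_cover ν hA hB hf hsub

theorem mem_of_sigmaFiniteSet (μ : RingMeasure R) {A : Set α} (hA : μ.SigmaFiniteSet A) :
    A ∈ R := by
  obtain ⟨B, hB, rfl⟩ := hA
  exact R.iUnion_mem B fun n => (hB n).1

/-- Products of `σ`-finite sets generate the `σ`-finite sets of the product measure. -/
theorem prod_sigmaFiniteRing (μ : RingMeasure R) (ν : RingMeasure Q) :
    μ.sigmaFiniteRing.prod ν.sigmaFiniteRing = (μ.prod ν).sigmaFiniteRing := by
  rw [sigmaFiniteRing_prod]
  refine SigmaRing.ext_mem fun C => ⟨fun hC => hC _ ?_, fun hC => hC _ ?_⟩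
  · rintro _ ⟨_, ⟨A, hA, rfl⟩, _, ⟨B, hB, rfl⟩, rfl⟩
    have e : (⋃ i, A i) ×ˢ (⋃ j, B j) = ⋃ i, ⋃ j, A i ×ˢ B j := by
      ext ⟨x, y⟩
      simp [mem_prod]
    rw [e]
    exact SigmaRing.iUnion_mem _ _ fun i => SigmaRing.iUnion_mem _ _ fun j =>
      SigmaRing.mem_generate ⟨_, hA i, _, hB j, rfl⟩
  · rintro _ ⟨A, hA, B, hB, rfl⟩
    exact SigmaRing.mem_generate ⟨A, ⟨fun _ => A, fun _ => hA, (iUnion_const _).symm⟩,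
      B, ⟨fun _ => B, fun _ => hB, (iUnion_const _).symm⟩, rfl⟩

theorem measurableFun_sigmaFiniteRing_iff (μ : RingMeasure R) {γ : Type*} [Zero γ]
    [MeasurableSpace γ] {f : α → γ} (hf : R.MeasurableFun f) :
    μ.sigmaFiniteRing.MeasurableFun f ↔ μ.SigmaFiniteSet {x | f x ≠ 0} := by
  refine ⟨fun h => h.2, fun h => SigmaRing.MeasurableFun.of_ideal ?_
    (fun E hE => μ.mem_of_sigmaFiniteSet hE) hf.1 h⟩
  rintro _ ⟨B, hB, rfl⟩ M hM hsub
  refine ⟨fun n => B n ∩ M, fun n => μ.finiteSets_inter (hB n) hM, ?_⟩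
  rw [← iUnion_inter, inter_eq_right.2 hsub]

end RingMeasure

/-! ### Fubini's theorem -/

theorem EReal.abs_eq_toENNReal_add (x : EReal) : x.abs = x.toENNReal + (-x).toENNReal := by
  induction x with
  | bot => simp
  | top => simp
  | coe x =>
    rw [EReal.abs_def, ← EReal.coe_neg, EReal.real_coe_toENNReal, EReal.real_coe_toENNReal]
    rcases le_total 0 x with h | h
    · rw [abs_of_nonneg h, ENNReal.ofReal_of_nonpos (neg_nonpos.2 h), add_zero]
    · rw [abs_of_nonpos h, ENNReal.ofReal_of_nonpos h, zero_add]

namespace SigmaRing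

variable {α : Type*} {R : SigmaRing α} {f : α → EReal}

theorem MeasurableFun.neg (hf : R.MeasurableFun f) : R.MeasurableFun fun x => -f x := by
  refine ⟨(continuous_neg.measurable (α := EReal)).comp hf.1, ?_⟩
  simpa using hf.2

theorem MeasurableFun.toENNReal (hf : R.MeasurableFun f) :
    R.MeasurableFun fun x => (f x).toENNReal :=
  R.measurableFun_of_support_subset hf.2 (measurable_ereal_toENNReal.comp hf.1) fun x hx => by
    simp [not_not.1 hx]

end SigmaRing

namespace RingMeasure

variable {α β : Type*} {R : SigmaRing α} {Q : SigmaRing β}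

theorem lintegral_add_of_measurable (μ : RingMeasure R) {f g : α → ℝ≥0∞}
    (hf : Measurable[R.toMeasurableSpace] f) :
    μ.lintegral (fun x => f x + g x) = μ.lintegral f + μ.lintegral g := by
  let _ := R.toMeasurableSpace
  exact lintegral_add_left hf g

theorem lintegral_abs (μ : RingMeasure R) {f : α → EReal} (hf : R.MeasurableFun f) :
    μ.lintegral (fun x => (f x).abs) =
      μ.lintegral (fun x => (f x).toENNReal) + μ.lintegral (fun x => (-f x).toENNReal) := by
  simp only [EReal.abs_eq_toENNReal_add]
  exact μ.lintegral_add_of_measurable hf.toENNReal.1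

theorem integrable_iff (μ : RingMeasure R) {f : α → EReal} (hf : R.MeasurableFun f) :
    μ.Integrable f ↔ μ.lintegral (fun x => (f x).toENNReal) ≠ ∞ ∧
      μ.lintegral (fun x => (-f x).toENNReal) ≠ ∞ := by
  rw [Integrable, μ.lintegral_abs hf, ENNReal.add_lt_top, lt_top_iff_ne_top, lt_top_iff_ne_top]
  exact and_iff_right hf

theorem integral_eq (μ : RingMeasure R) {f : α → EReal} (hf : μ.Integrable f) :
    μ.integral f = (μ.lintegral fun x => (f x).toENNReal).toReal -
      (μ.lintegral fun x => (-f x).toENNReal).toReal := by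
  rw [integral, if_pos hf]

theorem Integrable.neg {μ : RingMeasure R} {f : α → EReal} (hf : μ.Integrable f) :
    μ.Integrable fun x => -f x := by
  refine ⟨hf.1.neg, ?_⟩
  simpa only [EReal.abs_neg] using hf.2

theorem integral_neg_eq (μ : RingMeasure R) {f : α → EReal} (hf : μ.Integrable f) :
    μ.integral (fun x => -f x) = -μ.integral f := by
  rw [μ.integral_eq hf, μ.integral_eq hf.neg]
  simp

theorem sigmaFiniteSet_support (μ : RingMeasure R) {g : α → ℝ≥0∞} (hg : R.MeasurableFun g)
    (hfin : μ.lintegral g ≠ ∞) : μ.SigmaFiniteSet {x | g x ≠ 0} := by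
  let _ := R.toMeasurableSpace
  have hpos : ∀ n : ℕ, ((n : ℝ≥0∞) + 1)⁻¹ ≠ 0 := fun n => by simp
  have hmem : ∀ n : ℕ, {x | ((n : ℝ≥0∞) + 1)⁻¹ ≤ g x} ∈ R := fun n =>
    R.mem_of_subset hg.2 (measurableSet_le measurable_const hg.1) fun x hx h0 =>
      hpos n (le_zero_iff.1 (h0 ▸ hx))
  refine ⟨fun n => {x | ((n : ℝ≥0∞) + 1)⁻¹ ≤ g x}, fun n => ⟨hmem n, ?_⟩, ?_⟩
  · rw [← μ.toMeasure_apply (hmem n)]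
    exact (meas_ge_le_lintegral_div hg.1.aemeasurable (hpos n) (by simp)).trans_lt
      (ENNReal.div_lt_top hfin (hpos n))
  · ext x
    simp only [mem_ofPred_eq, mem_iUnion]
    refine ⟨fun hx => ?_, fun ⟨n, hn⟩ h0 => hpos n (le_zero_iff.1 (h0 ▸ hn))⟩
    obtain ⟨n, hn⟩ := ENNReal.exists_inv_nat_lt hx
    exact ⟨n, (ENNReal.inv_le_inv.2 le_self_add).trans hn.le⟩

/-- From Tonelli to Fubini, for an iterated integral in a fixed order: the positive and the negative
part of the partial integral `G` differ from the partial integrals of the positive and of the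
negative part by the same function, almost everywhere. -/
theorem integrable_partial_integral (μ : RingMeasure R) (ν : RingMeasure Q) {g : α → β → EReal}
    (hg : ∀ x, Q.MeasurableFun (g x))
    (hp : R.MeasurableFun fun x => ν.lintegral fun y => (g x y).toENNReal)
    (hn : R.MeasurableFun fun x => ν.lintegral fun y => (-g x y).toENNReal)
    (hpt : μ.lintegral (fun x => ν.lintegral fun y => (g x y).toENNReal) ≠ ∞)
    (hnt : μ.lintegral (fun x => ν.lintegral fun y => (-g x y).toENNReal) ≠ ∞) :
    μ.AE (fun x => ν.Integrable (g x)) ∧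
    μ.Integrable (fun x => ((ν.integral (g x) : ℝ) : EReal)) ∧
    μ.integral (fun x => ((ν.integral (g x) : ℝ) : EReal)) =
      (μ.lintegral fun x => ν.lintegral fun y => (g x y).toENNReal).toReal -
        (μ.lintegral fun x => ν.lintegral fun y => (-g x y).toENNReal).toReal := by
  have hint : ∀ x, ν.Integrable (g x) ↔ _ := fun x => ν.integrable_iff (hg x)
  have hval : ∀ x, ν.Integrable (g x) → ν.integral (g x) = _ := fun x => ν.integral_eq
  set p : α → ℝ≥0∞ := fun x => ν.lintegral fun y => (g x y).toENNReal
  set n : α → ℝ≥0∞ := fun x => ν.lintegral fun y => (-g x y).toENNReal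
  set G : α → ℝ := fun x => ν.integral (g x)
  have hG : ∀ x, G x =
      {x | p x ≠ ∞ ∧ n x ≠ ∞}.indicator (fun x => (p x).toReal - (n x).toReal) x := by
    intro x
    by_cases h : x ∈ {x | p x ≠ ∞ ∧ n x ≠ ∞}
    · rw [indicator_of_mem h]
      exact hval x ((hint x).2 h)
    · rw [indicator_of_notMem h]
      exact if_neg fun h' => h ((hint x).1 h')
  let _ := R.toMeasurableSpace
  have hmp : MeasurableSet {x | p x = ∞} := hp.1 (measurableSet_singleton _)
  have hmn : MeasurableSet {x | n x = ∞} := hn.1 (measurableSet_singleton _)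
  have hGmeas : Measurable G := by
    rw [funext hG]
    exact (hp.1.ennreal_toReal.sub hn.1.ennreal_toReal).indicator (hmp.compl.inter hmn.compl)
  have hGm : R.MeasurableFun fun x => (G x : EReal) := by
    refine R.measurableFun_of_support_subset (R.union_mem hp.2 hn.2)
      (measurable_coe_real_ereal.comp hGmeas) fun x hx => ?_
    simp only [mem_union, mem_ofPred_eq, not_or, not_not] at hx
    simp [hG, indicator, hx.1, hx.2]
  have hGp : ∀ x, ((G x : ℝ) : EReal).toENNReal ≤ p x := by
    intro x
    rw [EReal.real_coe_toENNReal, hG]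
    refine ENNReal.ofReal_le_of_le_toReal (indicator_apply_le' (fun _ => ?_) fun _ => ?_)
    · exact sub_le_self _ ENNReal.toReal_nonneg
    · exact ENNReal.toReal_nonneg
  have hGn : ∀ x, (-((G x : ℝ) : EReal)).toENNReal ≤ n x := by
    intro x
    rw [← EReal.coe_neg, EReal.real_coe_toENNReal, hG]
    refine ENNReal.ofReal_le_of_le_toReal (neg_le.1 (le_indicator_apply (fun _ => ?_) fun _ => ?_))
    · linarith [ENNReal.toReal_nonneg (a := p x)]
    · simp
  have hGint : μ.Integrable fun x => (G x : EReal) :=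
    (μ.integrable_iff hGm).2 ⟨ne_top_of_le_ne_top hpt (lintegral_mono hGp),
      ne_top_of_le_ne_top hnt (lintegral_mono hGn)⟩
  have haep : ∀ᵐ x ∂μ.toMeasure, p x < ∞ := ae_lt_top hp.1 hpt
  have haen : ∀ᵐ x ∂μ.toMeasure, n x < ∞ := ae_lt_top hn.1 hnt
  refine ⟨⟨{x | p x = ∞} ∪ {x | n x = ∞}, ?_, ?_, fun x hx => ?_⟩, hGint, ?_⟩
  · refine R.mem_of_subset (R.union_mem hp.2 hn.2) (hmp.union hmn) ?_
    exact union_subset_union (fun x (hx : p x = ∞) => by simp [hx])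
      (fun x (hx : n x = ∞) => by simp [hx])
  · rw [← μ.toMeasure_apply]
    · refine measure_union_null ?_ ?_
      · simpa [ae_iff] using haep
      · simpa [ae_iff] using haen
    · refine R.mem_of_subset (R.union_mem hp.2 hn.2) (hmp.union hmn) ?_
      exact union_subset_union (fun x (hx : p x = ∞) => by simp [hx])
        (fun x (hx : n x = ∞) => by simp [hx])
  · exact (hint x).2 (not_or.1 hx)
  -- Where both partial integrals are finite, `G = p - n`, hence `G⁺ + n = p + G⁻`.
  · have hbal : μ.lintegral (fun x => (G x : EReal).toENNReal) + μ.lintegral n =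
        μ.lintegral p + μ.lintegral (fun x => (-(G x : EReal)).toENNReal) := by
      rw [← μ.lintegral_add_of_measurable hGm.toENNReal.1, ← μ.lintegral_add_of_measurable hp.1]
      refine lintegral_congr_ae ?_
      filter_upwards [haep, haen] with x hxp hxn
      rw [← EReal.coe_neg, EReal.real_coe_toENNReal, EReal.real_coe_toENNReal, hG,
        indicator_of_mem (show x ∈ {x | p x ≠ ∞ ∧ n x ≠ ∞} from ⟨hxp.ne, hxn.ne⟩)]
      generalize p x = a at *
      generalize n x = b at *
      lift a to NNReal using hxp.ne
      lift b to NNReal using hxn.ne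
      rw [ENNReal.coe_toReal, ENNReal.coe_toReal]
      rcases le_total (a : ℝ) b with h | h
      · rw [ENNReal.ofReal_of_nonpos (by linarith), zero_add, ← ENNReal.ofReal_coe_nnreal,
          ← ENNReal.ofReal_coe_nnreal, ← ENNReal.ofReal_add (by positivity) (by linarith)]
        ring_nf
      · rw [ENNReal.ofReal_of_nonpos (neg_nonpos.2 (sub_nonneg.2 h)), add_zero,
          ← ENNReal.ofReal_coe_nnreal, ← ENNReal.ofReal_coe_nnreal,
          ← ENNReal.ofReal_add (by linarith) (by positivity)]
        ring_nf
    obtain ⟨h₁, h₂⟩ := (μ.integrable_iff hGm).1 hGint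
    rw [μ.integral_eq hGint]
    have := congrArg ENNReal.toReal hbal
    rw [ENNReal.toReal_add h₁ hnt, ENNReal.toReal_add hpt h₂] at this
    linarith

theorem fubini (μ : RingMeasure R) (ν : RingMeasure Q) {f : α × β → EReal}
    (hf : (μ.prod ν).Integrable f) :
    μ.AE (fun x => ν.Integrable fun y => f (x, y)) ∧
    ν.AE (fun y => μ.Integrable fun x => f (x, y)) ∧
    μ.Integrable (fun x => ((ν.integral fun y => f (x, y) : ℝ) : EReal)) ∧
    ν.Integrable (fun y => ((μ.integral fun x => f (x, y) : ℝ) : EReal)) ∧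
    (μ.prod ν).integral f = μ.integral (fun x => ((ν.integral fun y => f (x, y) : ℝ) : EReal)) ∧
    (μ.prod ν).integral f =
      ν.integral (fun y => ((μ.integral fun x => f (x, y) : ℝ) : EReal)) := by
  have hfin := ((μ.prod ν).integrable_iff hf.1).1 hf
  obtain ⟨p₁, p₂, p₃, p₄⟩ := μ.tonelli ν hf.1.toENNReal.1
    ((μ.prod ν).sigmaFiniteSet_support hf.1.toENNReal hfin.1)
  obtain ⟨n₁, n₂, n₃, n₄⟩ := μ.tonelli ν hf.1.neg.toENNReal.1
    ((μ.prod ν).sigmaFiniteSet_support hf.1.neg.toENNReal hfin.2)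
  obtain ⟨a₁, a₂, a₃⟩ := μ.integrable_partial_integral ν (g := fun x y => f (x, y))
    (fun x => hf.1.section_left x) p₁ n₁ (p₃ ▸ hfin.1) (n₃ ▸ hfin.2)
  obtain ⟨b₁, b₂, b₃⟩ := ν.integrable_partial_integral μ (g := fun y x => f (x, y))
    (fun y => hf.1.section_right y) p₂ n₂ (p₄ ▸ hfin.1) (n₄ ▸ hfin.2)
  refine ⟨a₁, b₁, a₂, b₂, ?_, ?_⟩
  · rw [a₃, (μ.prod ν).integral_eq hf, p₃, n₃]
  · rw [b₃, (μ.prod ν).integral_eq hf, p₄, n₄]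

end RingMeasure

/-! ### The Daniell–Stone integral of a functional given by a measure -/

/-- The inequality `f ≤ p + q`, with all negative parts moved to the other side. -/
theorem EReal.toENNReal_add_ofReal_neg_le {f : EReal} {p : ℝ≥0∞} {q : ℝ}
    (h : f ≤ (p : EReal) + (q : ℝ)) :
    f.toENNReal + ENNReal.ofReal (-q) ≤ p + (ENNReal.ofReal q + (-f).toENNReal) := by
  induction p using ENNReal.recTopCoe with
  | top => simp
  | coe p =>
    have e : ((p : ℝ≥0∞) : EReal) + (q : ℝ) = ((p + q : ℝ) : EReal) := rfl
    rw [e] at h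
    induction f with
    | bot => simp
    | top => exact absurd h (EReal.coe_lt_top _).not_ge
    | coe r =>
      rw [EReal.coe_le_coe_iff] at h
      rw [← EReal.coe_neg, EReal.real_coe_toENNReal, EReal.real_coe_toENNReal]
      simp only [ENNReal.ofReal]
      norm_cast
      rw [← NNReal.coe_le_coe]
      push_cast
      simp only [Real.coe_toNNReal']
      have hr := max_zero_sub_max_neg_zero_eq_self r
      have hq := max_zero_sub_max_neg_zero_eq_self q
      rw [max_comm] at hr hq
      linarith [max_comm r 0, max_comm (-r) 0, max_comm q 0, max_comm (-q) 0]

/-- The passage from a domination of positive parts to a domination by an increasing sequence of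
real functions. -/
theorem EReal.le_iSup_sum_sub {f : EReal} {w : ℕ → ℝ} (hw : ∀ n, 0 ≤ w n) {q : ℝ}
    (h : f.toENNReal + ENNReal.ofReal q ≤ ∑' n, ENNReal.ofReal (w n) + (-f).toENNReal) :
    f ≤ ⨆ k, ((∑ n ∈ Finset.range k, w n - q : ℝ) : EReal) := by
  refine le_of_forall_ge fun b hb => ?_
  have hb' := iSup_le_iff.1 hb
  induction b with
  | bot => exact absurd (hb' 0) (by simp)
  | top => exact le_top
  | coe c =>
    have hc : ∀ k, ∑ n ∈ Finset.range k, w n ≤ c + q := fun k => by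
      linarith [EReal.coe_le_coe_iff.1 (hb' k)]
    have hc0 : 0 ≤ c + q := by simpa using hc 0
    have hsum : ∑' n, ENNReal.ofReal (w n) ≤ ENNReal.ofReal (c + q) := by
      rw [ENNReal.tsum_eq_iSup_nat]
      refine iSup_le fun k => ?_
      rw [← ENNReal.ofReal_sum_of_nonneg fun n _ => hw n]
      exact ENNReal.ofReal_le_ofReal (hc k)
    have h' := h.trans (add_le_add_left hsum _)
    induction f with
    | bot => exact bot_le
    | top => exact absurd h' (by simp)
    | coe r =>
      rw [EReal.coe_le_coe_iff]
      rw [← EReal.coe_neg, EReal.real_coe_toENNReal, EReal.real_coe_toENNReal] at h'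
      simp only [ENNReal.ofReal] at h'
      norm_cast at h'
      rw [← NNReal.coe_le_coe] at h'
      push_cast at h'
      simp only [Real.coe_toNNReal', max_eq_left hc0] at h'
      have hr := max_zero_sub_max_neg_zero_eq_self r
      linarith [max_comm r 0, max_comm (-r) 0, le_max_left q 0]

namespace Daniell

variable {α : Type*} {L : Submodule ℝ (α → ℝ)} {I : L →ₗ[ℝ] ℝ}

/-- The outer integral of `g` formed with series of nonnegative elementary functions is at most `b`;
there is no condition in the case `b = ∞`. -/
def SeriesBound (I : L →ₗ[ℝ] ℝ) (g : α → ℝ≥0∞) (b : ℝ≥0∞) : Prop :=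
  b ≠ ∞ → ∀ ε : ℝ≥0∞, ε ≠ 0 → ∃ u : ℕ → L, (∀ n x, 0 ≤ (u n : α → ℝ) x) ∧
    (∀ x, g x ≤ ∑' n, ENNReal.ofReal ((u n : α → ℝ) x)) ∧
    ∑' n, ENNReal.ofReal (I (u n)) ≤ b + ε

theorem SeriesBound.zero (I : L →ₗ[ℝ] ℝ) : SeriesBound I (fun _ => 0) 0 :=
  fun _ _ _ => ⟨fun _ => 0, by simp, by simp, by simp⟩

theorem SeriesBound.tsum {ι : Type} [Countable ι] [Nonempty ι] {g : ι → α → ℝ≥0∞} {b : ι → ℝ≥0∞}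
    (h : ∀ i, SeriesBound I (g i) (b i)) :
    SeriesBound I (fun x => ∑' i, g i x) (∑' i, b i) := by
  intro hb ε hε
  obtain ⟨δ, hδ, hδε⟩ := ENNReal.exists_pos_sum_of_countable' hε ι
  choose u hu0 hu hub using fun i => h i (ENNReal.ne_top_of_tsum_ne_top hb i) (δ i) (hδ i).ne'
  obtain ⟨e⟩ := nonempty_equiv_of_countable (α := ℕ) (β := ι × ℕ)
  refine ⟨fun k => u (e k).1 (e k).2, fun k => hu0 _ _, fun x => ?_, ?_⟩
  · rw [e.tsum_eq (fun p : ι × ℕ => ENNReal.ofReal ((u p.1 p.2 : α → ℝ) x)), ENNReal.tsum_prod']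
    exact ENNReal.tsum_le_tsum fun i => hu i x
  · rw [e.tsum_eq (fun p : ι × ℕ => ENNReal.ofReal (I (u p.1 p.2))), ENNReal.tsum_prod']
    calc _ ≤ ∑' i, (b i + δ i) := ENNReal.tsum_le_tsum hub
      _ = (∑' i, b i) + ∑' i, δ i := ENNReal.tsum_add
      _ ≤ _ := by gcongr

theorem SeriesBound.add {g₁ g₂ : α → ℝ≥0∞} {b₁ b₂ : ℝ≥0∞} (h₁ : SeriesBound I g₁ b₁)
    (h₂ : SeriesBound I g₂ b₂) : SeriesBound I (fun x => g₁ x + g₂ x) (b₁ + b₂) := by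
  have := SeriesBound.tsum (I := I) (g := fun i : Bool => if i then g₁ else g₂)
    (b := fun i : Bool => if i then b₁ else b₂) (by rintro (_ | _) <;> simpa)
  simpa [tsum_bool] using this

theorem SeriesBound.const_mul {g : α → ℝ≥0∞} {b : ℝ≥0∞} (h : SeriesBound I g b) (c : NNReal) :
    SeriesBound I (fun x => c * g x) (c * b) := by
  rcases eq_or_ne c 0 with rfl | hc
  · simpa using SeriesBound.zero I
  have hc' : (c : ℝ≥0∞) ≠ 0 := by simpa using hc
  intro hb ε hε
  have hb' : b ≠ ∞ := fun h => hb (by rw [h, ENNReal.mul_top hc'])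
  obtain ⟨u, hu0, hu, hub⟩ := h hb' (ε / c) (ENNReal.div_ne_zero.2 ⟨hε, ENNReal.coe_ne_top⟩)
  have hcu : ∀ r : ℝ, ENNReal.ofReal (c * r) = c * ENNReal.ofReal r := fun r => by
    rw [ENNReal.ofReal_mul c.coe_nonneg, ENNReal.ofReal_coe_nnreal]
  refine ⟨fun n => (c : ℝ) • u n, fun n x => mul_nonneg c.2 (hu0 n x), fun x => ?_, ?_⟩
  · simp only [Submodule.coe_smul, Pi.smul_apply, smul_eq_mul, hcu, ENNReal.tsum_mul_left]
    gcongr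
    exact hu x
  · simp only [map_smul, smul_eq_mul, hcu, ENNReal.tsum_mul_left]
    calc _ ≤ c * (b + ε / c) := by gcongr
      _ = _ := by rw [mul_add, ENNReal.mul_div_cancel hc' ENNReal.coe_ne_top]

/-- The bound for indicators implies the bound for all measurable functions. -/
theorem SeriesBound.lintegral {_ : MeasurableSpace α} {m : Measure α}
    (hC : ∀ C, MeasurableSet C → SeriesBound I (C.indicator 1) (m C)) {g : α → ℝ≥0∞}
    (hg : Measurable g) : SeriesBound I g (∫⁻ x, g x ∂m) := by
  have hsimple : ∀ s : SimpleFunc α NNReal,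
      SeriesBound I (fun x => (s x : ℝ≥0∞)) (∫⁻ x, s x ∂m) := by
    intro s
    induction s using SimpleFunc.induction with
    | @const c C hmC =>
      have e : ∀ x, ((SimpleFunc.piecewise C hmC (SimpleFunc.const α c) (SimpleFunc.const α 0) x :
          NNReal) : ℝ≥0∞) = c * C.indicator 1 x := by
        intro x
        by_cases hx : x ∈ C <;> simp [hx]
      simp only [e]
      rw [lintegral_const_mul _ (measurable_one.indicator hmC), lintegral_indicator_one hmC]
      exact (hC C hmC).const_mul c
    | @add f g _ hf hg =>
      simp only [SimpleFunc.coe_add, Pi.add_apply, ENNReal.coe_add]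
      rw [lintegral_add_left f.measurable.coe_nnreal_ennreal]
      exact hf.add hg
  have := SeriesBound.tsum fun n => hsimple (SimpleFunc.eapproxDiff g n)
  rw [← lintegral_tsum fun n => (SimpleFunc.measurable _).coe_nnreal_ennreal.aemeasurable] at this
  simpa only [SimpleFunc.tsum_eapproxDiff g hg] using this

/-- The functional `I` is integration against `ρ`, for a space of elementary functions that are
`ρ`-integrable. -/
structure IsIntegration {R : SigmaRing α} (I : L →ₗ[ℝ] ℝ) (ρ : RingMeasure R) : Prop where
  measurable : ∀ φ : L, Measurable[R.toMeasurableSpace] (φ : α → ℝ)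
  integrable : ∀ φ : L, MeasureTheory.Integrable (φ : α → ℝ) ρ.toMeasure
  apply_eq : ∀ φ : L, I φ = ∫ x, (φ : α → ℝ) x ∂ρ.toMeasure

namespace IsIntegration

variable {R : SigmaRing α} {ρ : RingMeasure R}

theorem nonneg (h : IsIntegration I ρ) {φ : L} (hφ : ∀ x, 0 ≤ (φ : α → ℝ) x) : 0 ≤ I φ := by
  rw [h.apply_eq]
  exact integral_nonneg hφ

theorem ofReal_apply (h : IsIntegration I ρ) {φ : L} (hφ : ∀ x, 0 ≤ (φ : α → ℝ) x) :
    ENNReal.ofReal (I φ) = ρ.lintegral fun x => ENNReal.ofReal ((φ : α → ℝ) x) := by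
  rw [h.apply_eq]
  exact ofReal_integral_eq_lintegral_ofReal (h.integrable φ) (Filter.Eventually.of_forall hφ)

variable {φ : ℕ → L} {f : α → EReal}

theorem le_iSup_sub_add (hf : ∀ x, f x ≤ ⨆ n, (((φ n : α → ℝ) x : ℝ) : EReal)) (x : α) :
    f x ≤ ((⨆ n, ENNReal.ofReal ((φ n : α → ℝ) x - (φ 0 : α → ℝ) x) : ℝ≥0∞) : EReal) +
      ((φ 0 : α → ℝ) x : ℝ) := by
  refine (hf x).trans (iSup_le fun n => ?_)
  have h : ((((φ n : α → ℝ) x - (φ 0 : α → ℝ) x : ℝ)) : EReal) ≤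
      ((⨆ n, ENNReal.ofReal ((φ n : α → ℝ) x - (φ 0 : α → ℝ) x) : ℝ≥0∞) : EReal) := by
    refine le_trans ?_ (EReal.coe_ennreal_le_coe_ennreal_iff.2 (le_iSup _ n))
    rw [EReal.coe_ennreal_ofReal]
    exact EReal.coe_le_coe_iff.2 (le_max_left _ _)
  calc (((φ n : α → ℝ) x : ℝ) : EReal)
      = (((φ n : α → ℝ) x - (φ 0 : α → ℝ) x : ℝ) : EReal) + ((φ 0 : α → ℝ) x : ℝ) := by
        rw [← EReal.coe_add, sub_add_cancel]
    _ ≤ _ := by gcongr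

/-- Monotone convergence, for the increments over the first function of the sequence. -/
theorem lintegral_iSup_sub_le (h : IsIntegration I ρ)
    (hmono : ∀ x, Monotone fun n => (φ n : α → ℝ) x) {c : ℝ} (hc : ∀ n, I (φ n) ≤ c) :
    ρ.lintegral (fun x => ⨆ n, ENNReal.ofReal ((φ n : α → ℝ) x - (φ 0 : α → ℝ) x)) ≤
      ENNReal.ofReal (c - I (φ 0)) := by
  let _ := R.toMeasurableSpace
  rw [RingMeasure.lintegral, lintegral_iSup]
  · refine iSup_le fun n => ?_
    have := h.ofReal_apply (φ := φ n - φ 0) fun x => sub_nonneg.2 (hmono x (Nat.zero_le n))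
    refine (this.symm.trans_le ?_)
    rw [map_sub]
    exact ENNReal.ofReal_le_ofReal (sub_le_sub_right (hc n) _)
  · exact fun n => ((h.measurable _).sub (h.measurable _)).ennreal_ofReal
  · exact fun i j hij x => ENNReal.ofReal_le_ofReal (sub_le_sub_right (hmono x hij) _)

/-- For a measurable function, a finite upper integral bounds the positive part. -/
theorem lintegral_toENNReal_ne_top (h : IsIntegration I ρ)
    (hf : upperIntegral I f < ⊤) : ρ.lintegral (fun x => (f x).toENNReal) ≠ ∞ := by
  simp only [upperIntegral, iInf_lt_iff] at hf
  obtain ⟨φ, hmono, hφ, hlt⟩ := hf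
  obtain ⟨c, hc, -⟩ := EReal.lt_iff_exists_real_btwn.1 hlt
  have hc' : ∀ n, I (φ n) ≤ c := fun n => EReal.coe_le_coe_iff.1 ((le_iSup _ n).trans hc.le)
  let _ := R.toMeasurableSpace
  have h₁ : ρ.lintegral (fun x => ENNReal.ofReal ((φ 0 : α → ℝ) x)) ≠ ∞ :=
    (h.integrable (φ 0)).lintegral_lt_top.ne
  have h₂ := h.lintegral_iSup_sub_le hmono hc'
  have h₃ : ∀ x, (f x).toENNReal ≤ ENNReal.ofReal ((φ 0 : α → ℝ) x) +
      ⨆ n, ENNReal.ofReal ((φ n : α → ℝ) x - (φ 0 : α → ℝ) x) := by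
    intro x
    refine (EReal.toENNReal_le_toENNReal (le_iSup_sub_add hφ x)).trans
      (EReal.toENNReal_add_le.trans ?_)
    rw [EReal.toENNReal_coe, EReal.real_coe_toENNReal, add_comm]
  refine ne_top_of_le_ne_top ?_ (lintegral_mono h₃)
  have := ρ.lintegral_add_of_measurable (h.measurable (φ 0)).ennreal_ofReal
    (g := fun x => ⨆ n, ENNReal.ofReal ((φ n : α → ℝ) x - (φ 0 : α → ℝ) x))
  rw [RingMeasure.lintegral] at this
  rw [this]
  exact ENNReal.add_ne_top.2 ⟨h₁, ne_top_of_le_ne_top ENNReal.ofReal_ne_top h₂⟩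

/-- The integral is a lower bound of the upper integral: with `Φ` the supremum of the increments
`φₙ - φ₀`, the inequality `f⁺ + φ₀⁻ ≤ Φ + φ₀⁺ + f⁻` is integrated. -/
theorem integral_le_upperIntegral (h : IsIntegration I ρ) (hf : ρ.Integrable f) :
    (ρ.integral f : EReal) ≤ upperIntegral I f := by
  obtain ⟨hp, hn⟩ := (ρ.integrable_iff hf.1).1 hf
  refine le_iInf₂ fun φ hmono => le_iInf fun hφ => le_of_forall_ge fun b hb => ?_
  have hb' : ∀ n, ((I (φ n) : ℝ) : EReal) ≤ b := iSup_le_iff.1 hb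
  induction b with
  | bot => exact absurd (hb' 0) (by simp)
  | top => exact le_top
  | coe c =>
    have hc : ∀ n, I (φ n) ≤ c := fun n => EReal.coe_le_coe_iff.1 (hb' n)
    let _ := R.toMeasurableSpace
    have hm0 : Measurable (φ 0 : α → ℝ) := h.measurable _
    have h₁ : ρ.lintegral (fun x => ENNReal.ofReal ((φ 0 : α → ℝ) x)) ≠ ∞ :=
      (h.integrable (φ 0)).lintegral_lt_top.ne
    have h₂ : ρ.lintegral (fun x => ENNReal.ofReal (-(φ 0 : α → ℝ) x)) ≠ ∞ :=
      (h.integrable (φ 0)).neg.lintegral_lt_top.ne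
    have h₃ : I (φ 0) = _ :=
      (h.apply_eq (φ 0)).trans (integral_eq_lintegral_pos_part_sub_lintegral_neg_part
        (h.integrable (φ 0)))
    have h₄ : ρ.lintegral (fun x => (f x).toENNReal) +
          ρ.lintegral (fun x => ENNReal.ofReal (-(φ 0 : α → ℝ) x)) ≤
        ENNReal.ofReal (c - I (φ 0)) + (ρ.lintegral (fun x => ENNReal.ofReal ((φ 0 : α → ℝ) x)) +
          ρ.lintegral (fun x => (-f x).toENNReal)) := by
      rw [← ρ.lintegral_add_of_measurable hf.1.toENNReal.1,
        ← ρ.lintegral_add_of_measurable hm0.ennreal_ofReal]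
      refine (lintegral_mono fun x =>
        EReal.toENNReal_add_ofReal_neg_le (le_iSup_sub_add hφ x)).trans ?_
      refine (lintegral_add_right _ (hm0.ennreal_ofReal.add hf.1.neg.toENNReal.1)).trans_le ?_
      gcongr
      · exact h.lintegral_iSup_sub_le hmono hc
      · exact le_rfl
    have h₅ := ENNReal.toReal_mono (ENNReal.add_ne_top.2
      ⟨ENNReal.ofReal_ne_top, ENNReal.add_ne_top.2 ⟨h₁, hn⟩⟩) h₄
    rw [ENNReal.toReal_add hp h₂, ENNReal.toReal_add ENNReal.ofReal_ne_top
      (ENNReal.add_ne_top.2 ⟨h₁, hn⟩), ENNReal.toReal_add h₁ hn,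
      ENNReal.toReal_ofReal (sub_nonneg.2 (hc 0))] at h₅
    rw [ρ.integral_eq hf, EReal.coe_le_coe_iff]
    simp only [RingMeasure.lintegral] at h₅ ⊢
    linarith

/-- The upper integral is at most the integral. The positive part `f⁺` is dominated by a series of
elementary functions. For `f⁻`, a series `h ≥ f⁻` has to be used from below: a partial sum `ψ` of
`h` gives `f ≤ -ψ + (f⁺ + (h - f⁻))`, and the last function is again dominated by a series. -/
theorem upperIntegral_le_integral (h : IsIntegration I ρ)
    (hC : ∀ C, MeasurableSet[R.toMeasurableSpace] C →
      SeriesBound I (C.indicator 1) (ρ.toMeasure C))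
    (hf : ρ.Integrable f) : upperIntegral I f ≤ ρ.integral f := by
  obtain ⟨hp, hn⟩ := (ρ.integrable_iff hf.1).1 hf
  refine EReal.le_of_forall_lt_iff_le.1 fun c hc => ?_
  rw [EReal.coe_lt_coe_iff, ρ.integral_eq hf] at hc
  let _ := R.toMeasurableSpace
  have hmp : Measurable fun x => (f x).toENNReal := hf.1.toENNReal.1
  have hmn : Measurable fun x => (-f x).toENNReal := hf.1.neg.toENNReal.1
  set p := ρ.lintegral fun x => (f x).toENNReal with hpdef
  set n := ρ.lintegral fun x => (-f x).toENNReal with hndef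
  obtain ⟨e, he, hce⟩ : ∃ e : ℝ, 0 < e ∧ p.toReal - n.toReal + 3 * e ≤ c :=
    ⟨(c - (p.toReal - n.toReal)) / 3, by linarith, by linarith⟩
  have hε : ENNReal.ofReal e ≠ 0 := by simpa using he
  obtain ⟨u, hu0, hu, hub⟩ := SeriesBound.lintegral hC hmn hn _ hε
  set H : α → ℝ≥0∞ := fun x => ∑' k, ENNReal.ofReal ((u k : α → ℝ) x) with hHdef
  have hmu : ∀ k, Measurable fun x => ENNReal.ofReal ((u k : α → ℝ) x) :=
    fun k => (h.measurable (u k)).ennreal_ofReal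
  have hmH : Measurable H := .tsum hmu
  have hHint : ∑' k, ENNReal.ofReal (I (u k)) = ∫⁻ x, H x ∂ρ.toMeasure := by
    rw [hHdef, lintegral_tsum fun k => (hmu k).aemeasurable]
    exact tsum_congr fun k => h.ofReal_apply (hu0 k)
  have hHn : n ≤ ∫⁻ x, H x ∂ρ.toMeasure := lintegral_mono hu
  -- A partial sum `ψ` of the series with `I ψ ≥ ∫ f⁻ - e`.
  obtain ⟨M, hM⟩ : ∃ M, n.toReal - e ≤ ∑ k ∈ Finset.range M, I (u k) := by
    by_contra! hcon
    have hpos : 0 < n.toReal - e := by simpa using hcon 0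
    have : n ≤ ENNReal.ofReal (n.toReal - e) := by
      refine hHn.trans ?_
      rw [← hHint, ENNReal.tsum_eq_iSup_nat]
      refine iSup_le fun k => ?_
      rw [← ENNReal.ofReal_sum_of_nonneg fun i _ => h.nonneg (hu0 i)]
      exact ENNReal.ofReal_le_ofReal (hcon k).le
    have := ENNReal.toReal_mono ENNReal.ofReal_ne_top this
    rw [ENNReal.toReal_ofReal hpos.le] at this
    linarith
  set ψ : L := ∑ k ∈ Finset.range M, u k with hψ
  have hψH : ∀ x, ENNReal.ofReal ((ψ : α → ℝ) x) ≤ H x := by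
    intro x
    rw [hψ, Submodule.coe_sum, Finset.sum_apply,
      ENNReal.ofReal_sum_of_nonneg fun i _ => hu0 i x]
    exact ENNReal.sum_le_tsum _
  have hsub : ∫⁻ x, (H x - (-f x).toENNReal) ∂ρ.toMeasure ≤ ENNReal.ofReal e := by
    rw [lintegral_sub hmn hn (Filter.Eventually.of_forall hu), ← hHint]
    exact tsub_le_iff_left.2 hub
  have hg : Measurable fun x => (f x).toENNReal + (H x - (-f x).toENNReal) :=
    hmp.add (hmH.sub hmn)
  have hgint : ∫⁻ x, ((f x).toENNReal + (H x - (-f x).toENNReal)) ∂ρ.toMeasure ≤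
      p + ENNReal.ofReal e := by
    rw [lintegral_add_left hmp]
    gcongr
    exact le_rfl
  obtain ⟨w, hw0, hw, hwb⟩ := SeriesBound.lintegral hC hg
    (ne_top_of_le_ne_top (ENNReal.add_ne_top.2 ⟨hp, ENNReal.ofReal_ne_top⟩) hgint) _ hε
  have hwI : ∀ k, ∑ i ∈ Finset.range k, I (w i) ≤ p.toReal + e + e := by
    intro k
    rw [← ENNReal.ofReal_le_ofReal_iff (by positivity),
      ENNReal.ofReal_sum_of_nonneg fun i _ => h.nonneg (hw0 i),
      ENNReal.ofReal_add (by positivity) he.le, ENNReal.ofReal_add (by positivity) he.le,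
      ENNReal.ofReal_toReal hp]
    exact (ENNReal.sum_le_tsum _).trans (hwb.trans (by gcongr))
  have happ : ∀ k x, ((∑ i ∈ Finset.range k, w i - ψ : L) : α → ℝ) x =
      ∑ i ∈ Finset.range k, (w i : α → ℝ) x - (ψ : α → ℝ) x := by
    intro k x
    rw [Submodule.coe_sub, Submodule.coe_sum, Pi.sub_apply, Finset.sum_apply]
  refine iInf_le_of_le (fun k => ∑ i ∈ Finset.range k, w i - ψ) <|
    iInf_le_of_le (fun x => ?_) <| iInf_le_of_le (fun x => ?_) <| iSup_le fun k => ?_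
  · simp only [happ]
    refine monotone_nat_of_le_succ fun k => ?_
    rw [Finset.sum_range_succ]
    linarith [hw0 k x]
  · simp only [happ]
    refine EReal.le_iSup_sum_sub (fun i => hw0 i x) ?_
    calc (f x).toENNReal + ENNReal.ofReal ((ψ : α → ℝ) x)
        ≤ (f x).toENNReal + ((H x - (-f x).toENNReal) + (-f x).toENNReal) := by
          gcongr
          exact (hψH x).trans le_tsub_add
      _ = ((f x).toENNReal + (H x - (-f x).toENNReal)) + (-f x).toENNReal := by rw [add_assoc]
      _ ≤ _ := by
          gcongr
          exact hw x
  · rw [map_sub, map_sum, EReal.coe_le_coe_iff, hψ, map_sum]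
    linarith [hwI k]

theorem upperIntegral_eq (h : IsIntegration I ρ)
    (hC : ∀ C, MeasurableSet[R.toMeasurableSpace] C →
      SeriesBound I (C.indicator 1) (ρ.toMeasure C))
    (hf : ρ.Integrable f) : upperIntegral I f = ρ.integral f :=
  le_antisymm (h.upperIntegral_le_integral hC hf) (h.integral_le_upperIntegral hf)

theorem integrable_iff (h : IsIntegration I ρ)
    (hC : ∀ C, MeasurableSet[R.toMeasurableSpace] C →
      SeriesBound I (C.indicator 1) (ρ.toMeasure C))
    (hf : R.MeasurableFun f) : ρ.Integrable f ↔ Daniell.Integrable I f := by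
  refine ⟨fun hi => ⟨ρ.integral f, h.upperIntegral_eq hC hi, ?_⟩, ?_⟩
  · rw [lowerIntegral, h.upperIntegral_eq hC hi.neg, ρ.integral_neg_eq hi, EReal.coe_neg, neg_neg]
  · rintro ⟨a, ha, ha'⟩
    refine (ρ.integrable_iff hf).2 ⟨h.lintegral_toENNReal_ne_top ?_,
      h.lintegral_toENNReal_ne_top ?_⟩
    · rw [ha]
      exact EReal.coe_lt_top a
    · rw [lowerIntegral, neg_eq_iff_eq_neg, ← EReal.coe_neg] at ha'
      rw [ha']
      exact EReal.coe_lt_top _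

end IsIntegration

end Daniell

/-! ### The tensor product of the elementary functionals -/

namespace RingMeasure

variable {α β : Type*} {R : SigmaRing α} {Q : SigmaRing β}

theorem indicator_prod_one (A : Set α) (B : Set β) :
    (fun z : α × β => A.indicator (1 : α → ℝ) z.1 * B.indicator (1 : β → ℝ) z.2) =
      (A ×ˢ B).indicator 1 := by
  funext ⟨x, y⟩
  by_cases hx : x ∈ A <;> by_cases hy : y ∈ B <;> simp [hx, hy]

/-- The integral of a product `(x, y) ↦ u(x) v(y)` of simple functions. -/
theorem integral_mul_simple (μ : RingMeasure R) (ν : RingMeasure Q) {u : α → ℝ}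
    (hu : u ∈ μ.simpleSpace) {v : β → ℝ} (hv : v ∈ ν.simpleSpace) :
    Measurable[(R.prod Q).toMeasurableSpace] (fun z : α × β => u z.1 * v z.2) ∧
    MeasureTheory.Integrable (fun z : α × β => u z.1 * v z.2) (μ.prod ν).toMeasure ∧
    ∫ z, u z.1 * v z.2 ∂(μ.prod ν).toMeasure =
      (∫ x, u x ∂μ.toMeasure) * ∫ y, v y ∂ν.toMeasure := by
  let _ := (R.prod Q).toMeasurableSpace
  induction hu using Submodule.span_induction with
  | mem u hu =>
    obtain ⟨A, hA, rfl⟩ := hu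
    induction hv using Submodule.span_induction with
    | mem v hv =>
      obtain ⟨B, hB, rfl⟩ := hv
      have hAB := μ.mem_finiteSets_prod ν hA hB
      have hm := (R.prod Q).measurableSet_of_mem hAB.1
      rw [indicator_prod_one]
      refine ⟨measurable_one.indicator hm, ?_, ?_⟩
      · rw [integrable_indicator_iff hm]
        exact integrableOn_const (by rw [toMeasure_apply _ hAB.1]; exact hAB.2.ne)
      · rw [integral_indicator_one hm, measureReal_def, toMeasure_apply _ hAB.1]
        refine Eq.trans ?_ (congrArg₂ (· * ·) (μ.simpleFunctional_indicator hA)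
          (ν.simpleFunctional_indicator hB)).symm
        rw [← ENNReal.toReal_mul, prod_apply, μ.prodOuter_rect ν hA hB]
    | zero => simp
    | add v w hv hw h₁ h₂ =>
      simp only [Pi.add_apply, mul_add]
      refine ⟨h₁.1.add h₂.1, h₁.2.1.add h₂.2.1, ?_⟩
      rw [integral_add h₁.2.1 h₂.2.1, h₁.2.2, h₂.2.2,
        integral_add (ν.integrable_of_mem hv) (ν.integrable_of_mem hw), mul_add]
    | smul c v hv h₁ =>
      simp only [Pi.smul_apply, smul_eq_mul, mul_left_comm _ c]
      refine ⟨h₁.1.const_mul c, h₁.2.1.const_mul c, ?_⟩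
      rw [integral_const_mul, h₁.2.2, integral_const_mul, mul_left_comm]
  | zero => simp
  | add u w hu hw h₁ h₂ =>
    simp only [Pi.add_apply, add_mul]
    refine ⟨h₁.1.add h₂.1, h₁.2.1.add h₂.2.1, ?_⟩
    rw [integral_add h₁.2.1 h₂.2.1, h₁.2.2, h₂.2.2,
      integral_add (μ.integrable_of_mem hu) (μ.integrable_of_mem hw), add_mul]
  | smul c u hu h₁ =>
    simp only [Pi.smul_apply, smul_eq_mul, mul_assoc]
    refine ⟨h₁.1.const_mul c, h₁.2.1.const_mul c, ?_⟩
    rw [integral_const_mul, h₁.2.2, integral_const_mul, mul_assoc]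

theorem isIntegration_tensorFunctional (μ : RingMeasure R) (ν : RingMeasure Q) :
    Daniell.IsIntegration (μ.tensorFunctional ν) (μ.prod ν) := by
  have key : ∀ f (hf : f ∈ μ.tensorSpace ν), Measurable[(R.prod Q).toMeasurableSpace] f ∧
      MeasureTheory.Integrable f (μ.prod ν).toMeasure ∧
      μ.tensorFunctional ν ⟨f, hf⟩ = ∫ z, f z ∂(μ.prod ν).toMeasure := by
    intro f hf
    let _ := (R.prod Q).toMeasurableSpace
    induction hf using Submodule.span_induction with
    | mem f hf =>
      obtain ⟨u, hu, v, hv, rfl⟩ := hf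
      obtain ⟨h₁, h₂, h₃⟩ := μ.integral_mul_simple ν hu hv
      refine ⟨h₁, h₂, ?_⟩
      rw [h₃]
      change ∫ x, ∫ y, u x * v y ∂ν.toMeasure ∂μ.toMeasure = _
      simp only [integral_const_mul, integral_mul_const]
    | zero =>
      refine ⟨measurable_zero, integrable_zero _ _ _, ?_⟩
      simp only [Pi.zero_apply, integral_zero]
      exact (μ.tensorFunctional ν).map_zero
    | add f g hf hg h₁ h₂ =>
      refine ⟨h₁.1.add h₂.1, h₁.2.1.add h₂.2.1, ?_⟩
      simp only [Pi.add_apply]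
      rw [integral_add h₁.2.1 h₂.2.1, ← h₁.2.2, ← h₂.2.2]
      exact (μ.tensorFunctional ν).map_add ⟨f, hf⟩ ⟨g, hg⟩
    | smul c f hf h₁ =>
      refine ⟨h₁.1.const_mul c, h₁.2.1.const_mul c, ?_⟩
      simp only [Pi.smul_apply, smul_eq_mul]
      rw [integral_const_mul, ← h₁.2.2]
      exact (μ.tensorFunctional ν).map_smul c ⟨f, hf⟩
  exact ⟨fun φ => (key φ φ.2).1, fun φ => (key φ φ.2).2.1, fun φ => (key φ φ.2).2.2⟩

/-- By its definition as an infimum over covers, the product measure of a set dominates the outer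
integral of the indicator. -/
theorem seriesBound_indicator (μ : RingMeasure R) (ν : RingMeasure Q) {C : Set (α × β)}
    (hC : MeasurableSet[(R.prod Q).toMeasurableSpace] C) :
    Daniell.SeriesBound (μ.tensorFunctional ν) (C.indicator 1) ((μ.prod ν).toMeasure C) := by
  intro hfin ε hε
  have hmem : C ∈ R.prod Q := by
    by_contra h
    exact hfin ((μ.prod ν).toMeasure_apply_of_notMem hC h)
  rw [toMeasure_apply _ hmem, prod_apply] at hfin ⊢
  obtain ⟨A, B, hA, hB, hsub, hle⟩ := μ.exists_cover_of_prodOuter_lt_top ν hfin hε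
  have hL : ∀ n, (A n ×ˢ B n).indicator 1 ∈ μ.tensorSpace ν := fun n =>
    Submodule.subset_span ⟨_, Submodule.subset_span ⟨_, hA n, rfl⟩, _,
      Submodule.subset_span ⟨_, hB n, rfl⟩, (indicator_prod_one _ _).symm⟩
  have hI : ∀ n, μ.tensorFunctional ν ⟨_, hL n⟩ = (μ (A n) * ν (B n)).toReal := by
    intro n
    let _ := (R.prod Q).toMeasurableSpace
    have hAB := (μ.mem_finiteSets_prod ν (hA n) (hB n)).1
    rw [(μ.isIntegration_tensorFunctional ν).apply_eq,
      integral_indicator_one ((R.prod Q).measurableSet_of_mem hAB), measureReal_def,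
      toMeasure_apply _ hAB, prod_apply, μ.prodOuter_rect ν (hA n) (hB n)]
  refine ⟨fun n => ⟨_, hL n⟩, fun n x => indicator_nonneg (fun _ _ => zero_le_one) x,
    fun x => indicator_apply_le' (fun hx => ?_) fun _ => zero_le, ?_⟩
  · obtain ⟨n, hn⟩ := mem_iUnion.1 (hsub hx)
    refine le_trans ?_ (ENNReal.le_tsum n)
    simp [indicator_of_mem hn]
  · simp only [hI]
    refine le_trans (le_of_eq (tsum_congr fun n => ?_)) hle
    exact ENNReal.ofReal_toReal (ENNReal.mul_lt_top (hA n).2 (hB n).2).ne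

end RingMeasure

/-- For arbitrary measure spaces `(S, 𝔖, μ)` and `(T, 𝔗, ν)` over `σ`-rings: the characterization of
the product measure, its integral as a Daniell–Stone integral, the Fubini theorem and the Tonelli
theorem. -/
theorem mainTheorem1 {S T : Type*} (𝔖 : SigmaRing S) (𝔗 : SigmaRing T)
    (μ : RingMeasure 𝔖) (ν : RingMeasure 𝔗) :
    -- `μ ⊗ ν` is the product measure
    (RingMeasure.IsProduct μ ν (μ.prod ν) ∧
      ∀ ρ : RingMeasure (𝔖.prod 𝔗), RingMeasure.IsProduct μ ν ρ →
        ∀ C ∈ 𝔖.prod 𝔗, ρ C = μ.prod ν C) ∧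
    -- (i) Lebesgue integral and Daniell–Stone integral
    (∀ f : S × T → EReal, (𝔖.prod 𝔗).MeasurableFun f →
      ((μ.prod ν).Integrable f ↔ Daniell.Integrable (μ.tensorFunctional ν) f) ∧
      ((μ.prod ν).Integrable f →
        (μ.prod ν).integral f = Daniell.integral (μ.tensorFunctional ν) f)) ∧
    -- (ii) Fubini
    (∀ f : S × T → EReal, (μ.prod ν).Integrable f →
      μ.AE (fun s => ν.Integrable fun t => f (s, t)) ∧
      ν.AE (fun t => μ.Integrable fun s => f (s, t)) ∧
      μ.Integrable (fun s => ((ν.integral fun t => f (s, t) : ℝ) : EReal)) ∧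
      ν.Integrable (fun t => ((μ.integral fun s => f (s, t) : ℝ) : EReal)) ∧
      (μ.prod ν).integral f = μ.integral (fun s => ((ν.integral fun t => f (s, t) : ℝ) : EReal)) ∧
      (μ.prod ν).integral f = ν.integral (fun t => ((μ.integral fun s => f (s, t) : ℝ) : EReal))) ∧
    -- (iii) Tonelli
    (∀ f : S × T → ENNReal, (𝔖.prod 𝔗).MeasurableFun f →
      ((μ.sigmaFiniteRing.prod ν.sigmaFiniteRing).MeasurableFun f ↔
        (μ.prod ν).SigmaFiniteSet {z | f z ≠ 0}) ∧
      ((μ.prod ν).SigmaFiniteSet {z | f z ≠ 0} →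
        (∀ s, 𝔗.MeasurableFun fun t => f (s, t)) ∧
        (∀ t, 𝔖.MeasurableFun fun s => f (s, t)) ∧
        𝔖.MeasurableFun (fun s => ν.lintegral fun t => f (s, t)) ∧
        𝔗.MeasurableFun (fun t => μ.lintegral fun s => f (s, t)) ∧
        (μ.prod ν).lintegral f = μ.lintegral (fun s => ν.lintegral fun t => f (s, t)) ∧
        (μ.prod ν).lintegral f = ν.lintegral (fun t => μ.lintegral fun s => f (s, t)) ∧
        ((μ.prod ν).lintegral f < ⊤ ∨
            μ.lintegral (fun s => ν.lintegral fun t => f (s, t)) < ⊤ ∨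
            ν.lintegral (fun t => μ.lintegral fun s => f (s, t)) < ⊤ →
          (μ.prod ν).Integrable fun z => (f z : EReal)))) := by
  refine ⟨⟨μ.isProduct_prod ν, fun ρ hρ C hC => hρ.eq_prod hC⟩, fun f hf => ⟨?_, fun hi => ?_⟩,
    fun f hf => μ.fubini ν hf, fun f hf => ⟨?_, fun hs => ?_⟩⟩
  · exact (μ.isIntegration_tensorFunctional ν).integrable_iff
      (fun C hC => μ.seriesBound_indicator ν hC) hf
  · rw [Daniell.integral, (μ.isIntegration_tensorFunctional ν).upperIntegral_eq
      (fun C hC => μ.seriesBound_indicator ν hC) hi, EReal.toReal_coe]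
  · rw [μ.prod_sigmaFiniteRing ν]
    exact (μ.prod ν).measurableFun_sigmaFiniteRing_iff hf
  · obtain ⟨h₁, h₂, h₃, h₄⟩ := μ.tonelli ν hf.1 hs
    refine ⟨hf.section_left, hf.section_right, h₁, h₂, h₃, h₄, fun h => ?_⟩
    have hfin : (μ.prod ν).lintegral f < ⊤ := by
      rcases h with h | h | h
      · exact h
      · exact h₃ ▸ h
      · exact h₄ ▸ h
    have hm : (𝔖.prod 𝔗).MeasurableFun fun z => (f z : EReal) :=
      (𝔖.prod 𝔗).measurableFun_of_support_subset hf.2 (measurable_coe_ennreal_ereal.comp hf.1)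
        fun z hz => by simp [not_not.1 hz]
    refine ((μ.prod ν).integrable_iff hm).2 ⟨?_, ?_⟩
    · simpa only [EReal.toENNReal_coe] using hfin.ne
    · have : ∀ z, (-(f z : EReal)).toENNReal = 0 := fun z =>
        EReal.toENNReal_of_nonpos (by simpa using EReal.coe_ennreal_nonneg (f z))
      simp only [this]
      simp [RingMeasure.lintegral]
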